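/- **Setting.** Let $X$ be a locally compact space with countable base whose topology is given by a metric $\rho$; write $B(x,r)=\{y\in X:\rho(x,y)<r\}$. Let $\mathcal W$ be a convex cone of lower semicontinuous functions $X\to[0,\infty]$ such that $(X,\mathcal W)$ is a balayage space and $1\in\mathcal W$. That is: * $\mathcal W$ linearly separates the points of $X$; $w=\sup\{v\in\mathcal W\cap C(X): v\le w\}$ for every $w\in\mathcal W$; and there are strictly positive $u,v\in\mathcal W\cap C(X)$ with $u/v\to0$ at infinity, where $C(X)$ denotes the continuous real functions; * if $v_n\in\mathcal W$ and $v_n\uparrow v$, then $v\in\mathcal W$; * for every $\mathcal V\subset\mathcal W$, the greatest finely lower semicontinuous minorant of $\inf\mathcal V$ belongs to $\mathcal W$, where the fine topology is the coarsest topology that is finer than the given one and makes all functions in $\mathcal W$ continuous; * if $u,v_1,v_2\in\mathcal W$ and $u\le v_1+v_2$, then $u=u_1+u_2$ with $u_i\in\mathcal W$ and $u_i\le v_i$. For $A\subset X$ and $u:X\to[0,\infty]$ let $R_u^A=\inf\{v\in\mathcal W: v\ge u\text{ on }A\}$. Let $\varepsilon_x^A$ be the reduced measure, i.e. the unique Borel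 measure with $\int p\,d\varepsilon_x^A=R_p^A(x)$ for all continuous real potentials $p$, i.e. all $p\in\mathcal W\cap C(X)$ such that $p/q\to0$ at infinity for some strictly positive $q\in\mathcal W\cap C(X)$. (Then $\int u\,d\varepsilon_x^A=R_u^A(x)$ for all $u\in\mathcal W$.) A potential is a function $p\in\mathcal W$ such that $R_p^{V^c}$ is continuous and real on $V$ for every relatively compact open $V$, and the infimum of $R_p^{V^c}$ over all such $V$ is $0$. A Borel function $h:X\to[0,\infty]$ is harmonic on an open set $U$ if it is continuous and real on $U$ and $\int h\,d\varepsilon_x^{V^c}=h(x)$ for every open $V$ whose closure is a compact subset of $U$ and every $x\in V$. **Green function.** Let $G:X\times X\to(0,\infty]$ be Borel measurable with $G=\infty$ on the diagonal. Assume that every $G(\cdot,y)$ is a potential which is harmonic on $X\setminus\{y\}$, and that every potential is of the form $\int G(\cdot,y)\,d\mu(y)$ for some measure $\mu$ on $X$. Assume that there are a decreasing $g:[0,\infty)\to(0,\infty]$ and constants $c\ge1$, $c_D>1$, $\alpha_0,\eta_0\in(0,1)$, $0<R_0\le\infty$ with $c^{-1}g\circ\rho\le G\le c\,g\circ\rho$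 and, for $0<r<R_0$, $$g(r/2)\le c_D\,g(r),\qquad g(r)\le\eta_0\,g(\alpha_0r).$$ For open $V$ and $y\in V$ let $G_V(\cdot,y)=G(\cdot,y)-R^{V^c}_{G(\cdot,y)}$. **Ikeda–Watanabe type estimate.** Let $\lambda$ be a measure on $X$, $N$ a kernel on $X$, $M_N\ge3$ and $C_N\ge1$ such that, for all $x\in X$ and $0<r<R_0$, $$C_N^{-1}\varepsilon_x^{B(x,r)^c}\le\int_{B(x,r)} G_{B(x,r)}(x,z)\,N(z,\cdot)\,d\lambda(z)\le C_N\,\varepsilon_x^{B(x,r)^c}\quad\text{on }B(x,M_Nr)^c.$$ **Proposition.** Suppose that there exist $C\ge1$, $a\ge3$ and $R>0$ such that, for all $x\in X$, $0<r<R$ and $y\in B(x,r)$, $$N(x,\cdot)\le C\,N(y,\cdot)\quad\text{on }B(y,ar)^c$$ and $$\int_{B(x,r)}g(\rho(x,z))\,d\lambda(z)\le C\int_{B(y,2r)}g(\rho(y,z))\,d\lambda(z).$$ Then there exist $0<R_1\le\infty$, $c_J\in(0,\infty)$ and $0<\alpha<1/2$ such that, for all $x\in X$, $0<r<R_1$ and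 $y\in B(x,\alpha r)$, $$\varepsilon_x^{B(x,\alpha r)^c}\le c_J\,\varepsilon_y^{B(y,r)^c}\quad\text{on }B(y,r)^c.$$ -/

import Mathlib

open MeasureTheory Filter Topology Set
open scoped ENNReal NNReal

namespace Balayage

section Cone

variable {X : Type*} [TopologicalSpace X]

/-- A continuous real function (with values in `[0, ∞)`, regarded as a numerical function). -/
def IsContReal (f : X → ℝ≥0∞) : Prop :=
  Continuous f ∧ ∀ x, f x ≠ ∞

/-- The fine topology of a set `W` of numerical functions: the coarsest topology which is finer
than the given one and for which every function in `W` is continuous. -/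
@[reducible] def fineTopology (W : Set (X → ℝ≥0∞)) : TopologicalSpace X :=
  ‹TopologicalSpace X› ⊓ ⨅ w ∈ W, TopologicalSpace.induced w inferInstance

/-- The greatest finely lower semicontinuous minorant of `f`. -/
noncomputable def fineLscReg (W : Set (X → ℝ≥0∞)) (f : X → ℝ≥0∞) (x : X) : ℝ≥0∞ :=
  liminf f (@nhds X (fineTopology W) x)

/-- `(X, W)` is a balayage space: `W` is a convex cone of positive lower semicontinuous numerical
functions on `X` which linearly separates points, is generated by its continuous members, contains
strictly positive continuous `u, v` with `u / v → 0` at infinity, is stable under increasing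
limits and under finely lower semicontinuous regularized infima, and has the Riesz decomposition
property. (If `1 ∈ W`, linear separation is the same as separation of points.) -/
structure IsBalayageSpace (W : Set (X → ℝ≥0∞)) : Prop where
  lsc : ∀ w ∈ W, LowerSemicontinuous w
  add_mem : ∀ u ∈ W, ∀ v ∈ W, u + v ∈ W
  smul_mem : ∀ a : ℝ≥0, ∀ u ∈ W, (fun x => (a : ℝ≥0∞) * u x) ∈ W
  separates : ∀ x y : X, x ≠ y → ∀ a : ℝ≥0, ∃ w ∈ W, w x ≠ (a : ℝ≥0∞) * w y
  eq_sup : ∀ w ∈ W, ∀ x, w x = ⨆ v ∈ {v | v ∈ W ∧ IsContReal v ∧ v ≤ w}, v x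
  exists_pos : ∃ u ∈ W, ∃ v ∈ W, IsContReal u ∧ IsContReal v ∧
    (∀ x, 0 < u x) ∧ (∀ x, 0 < v x) ∧ Tendsto (fun x => u x / v x) (cocompact X) (𝓝 0)
  iSup_mem : ∀ v : ℕ → X → ℝ≥0∞, (∀ n, v n ∈ W) → Monotone v → (fun x => ⨆ n, v n x) ∈ W
  fineLscReg_mem : ∀ V : Set (X → ℝ≥0∞), V ⊆ W → fineLscReg W (fun x => ⨅ v ∈ V, v x) ∈ W
  riesz : ∀ u ∈ W, ∀ v₁ ∈ W, ∀ v₂ ∈ W, u ≤ v₁ + v₂ →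
    ∃ u₁ ∈ W, ∃ u₂ ∈ W, u = u₁ + u₂ ∧ u₁ ≤ v₁ ∧ u₂ ≤ v₂

/-- The reduced function `R_u^A = inf {v ∈ W : v ≥ u on A}`. -/
noncomputable def reduced (W : Set (X → ℝ≥0∞)) (A : Set X) (u : X → ℝ≥0∞) (x : X) : ℝ≥0∞ :=
  ⨅ v ∈ {v | v ∈ W ∧ ∀ y ∈ A, u y ≤ v y}, v x

/-- The continuous real potentials: those `p ∈ W ∩ C(X)` for which there is a strictly positive
`q ∈ W ∩ C(X)` such that `p / q` vanishes at infinity. -/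
def contPotentials (W : Set (X → ℝ≥0∞)) : Set (X → ℝ≥0∞) :=
  {p | p ∈ W ∧ IsContReal p ∧ ∃ q ∈ W, IsContReal q ∧ (∀ x, 0 < q x) ∧
    Tendsto (fun x => p x / q x) (cocompact X) (𝓝 0)}

/-- `p` is a potential: `p ∈ W`, for every relatively compact open `V` the function `R_p^{V^c}` is
continuous and real on `V`, and the infimum of all these functions is `0`. -/
def IsPotential (W : Set (X → ℝ≥0∞)) (p : X → ℝ≥0∞) : Prop :=
  p ∈ W ∧
  (∀ V : Set X, IsOpen V → IsCompact (closure V) →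
    ContinuousOn (reduced W Vᶜ p) V ∧ ∀ x ∈ V, reduced W Vᶜ p x ≠ ∞) ∧
  ∀ x, ⨅ V ∈ {V : Set X | IsOpen V ∧ IsCompact (closure V)}, reduced W Vᶜ p x = 0

/-- The Green function `G_V(x, y) = G(x, y) - R_{G(·, y)}^{V^c}(x)` of an open set `V`;
it is used for `y ∈ V` only. -/
noncomputable def greenOn (W : Set (X → ℝ≥0∞)) (G : X → X → ℝ≥0∞) (V : Set X) (x y : X) :
    ℝ≥0∞ :=
  G x y - reduced W Vᶜ (fun z => G z y) x

end Cone

section Measures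

variable {X : Type*} [TopologicalSpace X] [MeasurableSpace X]

/-- `μ` represents `p ↦ R_p^A(x)` on the continuous real potentials. In a balayage space exactly
one Borel measure does so, and it then satisfies `∫ u dμ = R_u^A(x)` for every `u ∈ W`. -/
def IsReducedMeasure (W : Set (X → ℝ≥0∞)) (A : Set X) (x : X) (μ : Measure X) : Prop :=
  ∀ p ∈ contPotentials W, ∫⁻ y, p y ∂μ = reduced W A p x

open Classical in
/-- The reduced measure `ε_x^A`. -/
noncomputable def reducedMeasure (W : Set (X → ℝ≥0∞)) (A : Set X) (x : X) : Measure X :=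
  if h : ∃ μ : Measure X, IsReducedMeasure W A x μ then h.choose else 0

/-- `h` is a positive Borel function on `X` which is harmonic on the open set `U`: it is continuous
and real on `U`, and `∫ h dε_x^{V^c} = h(x)` whenever `x ∈ V`, `V` is open and the closure of `V` is
a compact subset of `U`. -/
def IsHarmonicOn (W : Set (X → ℝ≥0∞)) (U : Set X) (h : X → ℝ≥0∞) : Prop :=
  Measurable h ∧ ContinuousOn h U ∧ (∀ x ∈ U, h x ≠ ∞) ∧
  ∀ V : Set X, IsOpen V → IsCompact (closure V) → closure V ⊆ U →
    ∀ x ∈ V, ∫⁻ y, h y ∂(reducedMeasure W Vᶜ x) = h x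

/-- `μ ≤ C ν` on the set `S`, for measures `μ, ν`. -/
def LEOn (S : Set X) (μ : Measure X) (C : ℝ≥0) (ν : Measure X) : Prop :=
  ∀ E : Set X, MeasurableSet E → E ⊆ S → μ E ≤ C * ν E

end Measures

section Metric

variable {X : Type*} [MetricSpace X] [MeasurableSpace X]

/-- The standing assumption: `G` is a Green function for `(X, W)`, infinite on the diagonal and
comparable to `g ∘ ρ`, where `ρ` is the metric of `X` and `g` is decreasing and strictly positive
on `[0, ∞)`, with the doubling property and weak upper decay on `(0, R₀)`. -/
structure GreenAssumption (W : Set (X → ℝ≥0∞)) (G : X → X → ℝ≥0∞) (g : ℝ → ℝ≥0∞)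
    (c cD : ℝ≥0) (α₀ : ℝ) (η₀ : ℝ≥0) (R₀ : ℝ≥0∞) : Prop where
  measurable : Measurable (Function.uncurry G)
  pos : ∀ x y, 0 < G x y
  diag : ∀ x, G x x = ∞
  potential : ∀ y, IsPotential W (fun x => G x y)
  harmonic : ∀ y, IsHarmonicOn W {y}ᶜ (fun x => G x y)
  represent : ∀ p, IsPotential W p → ∃ μ : Measure X, ∀ x, p x = ∫⁻ y, G x y ∂μ
  g_anti : AntitoneOn g (Ici 0)
  g_pos : ∀ t, 0 ≤ t → 0 < g t
  one_le_c : 1 ≤ c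
  one_lt_cD : 1 < cD
  α₀_pos : 0 < α₀
  α₀_lt : α₀ < 1
  η₀_pos : 0 < η₀
  η₀_lt : η₀ < 1
  R₀_pos : 0 < R₀
  lower : ∀ x y, (c : ℝ≥0∞)⁻¹ * g (dist x y) ≤ G x y
  upper : ∀ x y, G x y ≤ c * g (dist x y)
  doubling : ∀ r : ℝ, 0 < r → ENNReal.ofReal r < R₀ → g (r / 2) ≤ cD * g r
  decay : ∀ r : ℝ, 0 < r → ENNReal.ofReal r < R₀ → g r ≤ η₀ * g (α₀ * r)

/-- The estimate of Ikeda-Watanabe type: for all balls `B = B(x, r)`, `0 < r < R₀`,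
`C_N⁻¹ ε_x^{B^c} ≤ ∫_B G_B(x, z) N(z, ·) dλ(z) ≤ C_N ε_x^{B^c}` on `B(x, M_N r)^c`. -/
def IkedaWatanabe (W : Set (X → ℝ≥0∞)) (G : X → X → ℝ≥0∞) (R₀ : ℝ≥0∞)
    (lam : Measure X) (N : ProbabilityTheory.Kernel X X) (MN : ℝ) (CN : ℝ≥0) : Prop :=
  ∀ (x : X) (r : ℝ), 0 < r → ENNReal.ofReal r < R₀ →
    ∀ E : Set X, MeasurableSet E → E ⊆ (Metric.ball x (MN * r))ᶜ →
      (CN : ℝ≥0∞)⁻¹ * reducedMeasure W (Metric.ball x r)ᶜ x E ≤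
          ∫⁻ z in Metric.ball x r, greenOn W G (Metric.ball x r) x z * N z E ∂lam ∧
      ∫⁻ z in Metric.ball x r, greenOn W G (Metric.ball x r) x z * N z E ∂lam ≤
          CN * reducedMeasure W (Metric.ball x r)ᶜ x E

/-- The assumption on jumps: for some `0 < R₁ ≤ ∞`, `c_J > 0` and `0 < α < 1/2`, for all `x`,
`0 < r < R₁` and `y ∈ B(x, α r)`, `ε_x^{B(x, α r)^c} ≤ c_J ε_y^{B(y, r)^c}` on `B(y, r)^c`. -/
def JumpAssumption (W : Set (X → ℝ≥0∞)) : Prop :=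
  ∃ (R₁ : ℝ≥0∞) (cJ : ℝ≥0) (α : ℝ), 0 < R₁ ∧ 0 < cJ ∧ 0 < α ∧ α < 1 / 2 ∧
    ∀ (x : X) (r : ℝ), 0 < r → ENNReal.ofReal r < R₁ → ∀ y ∈ Metric.ball x (α * r),
      LEOn (Metric.ball y r)ᶜ (reducedMeasure W (Metric.ball x (α * r))ᶜ x) cJ
        (reducedMeasure W (Metric.ball y r)ᶜ y)

end Metric

end Balayage

/-! Put s = αr and t = r / M_N, and let E lie outside B(y, r). The Ikeda–Watanabe estimate turns
ε_x^{B(x,s)^c}(E) into an integral of G_{B(x,s)}(x, z) N(z, E) over B(x, s). There G_{B(x,s)} ≤ c g,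
and N(z, E) is at most a multiple of N(x, E), hence of N(y, E). The hypothesis on integrals of g
moves the remaining integral to B(y, 2s).

The way back at y needs the reverse bound g(ρ(y, z)) ≤ 2c G_{B(y,t)}(y, z) for z close to y. It
holds because, by the decay of g, the part of G(·, z) reduced on B(y, t)^c is less than half of G(y,
z) once ρ(y, z) is a small multiple of t (`exists_le_greenOn_ball`). The estimate for B(y, t) then
yields ε_y^{B(y,t)^c}(E), which is at most ε_y^{B(y,r)^c}(E).

This last monotonicity, obvious for a process, is the main potential-theoretic work. As
`reducedMeasure` is chosen with default value 0, existence comes first: u ↦ R_u^A(x) is additive by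
Riesz decomposition, so a positive extension and Riesz–Markov give a measure. For A closed in the
interior of B, every open U with A ⊆ U ⊆ B satisfies 1_A (p - q) + R_q^U ≤ R_p^U for q ≤ p.
Integrating against ε_y^B preserves R^U at y, and letting U shrink to A gives ε_y^B ≤ ε_y^A on A,
tested on differences of continuous potentials. These differences generate the topology, so they
suffice to compare measures. -/

namespace Balayage

/-! ### Representation of monotone additive functionals by measures. -/

/-- A monotone additive functional on a cone of finite functions extends to a positive linear
functional on all functions dominated by a member of the cone. -/
theorem exists_positive_extension {X : Type*} (K : Set (X → ℝ≥0∞))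
    (hfin : ∀ u ∈ K, ∀ x, u x ≠ ∞) (hadd : ∀ u ∈ K, ∀ v ∈ K, u + v ∈ K)
    (hsmul : ∀ a : ℝ≥0, ∀ u ∈ K, (fun x => (a : ℝ≥0∞) * u x) ∈ K) (hne : K.Nonempty)
    (φ : (X → ℝ≥0∞) → ℝ≥0∞) (φfin : ∀ u ∈ K, φ u ≠ ∞)
    (φadd : ∀ u ∈ K, ∀ v ∈ K, φ (u + v) = φ u + φ v)
    (φsmul : ∀ a : ℝ≥0, ∀ u ∈ K, φ (fun x => (a : ℝ≥0∞) * u x) = a * φ u)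
    (φmono : ∀ u ∈ K, ∀ v ∈ K, u ≤ v → φ u ≤ φ v) :
    ∃ (E : Submodule ℝ (X → ℝ)) (L : E →ₗ[ℝ] ℝ),
      (∀ f, f ∈ E ↔ ∃ u ∈ K, ∀ x, |f x| ≤ (u x).toReal) ∧
      (∀ f : E, (∀ x, 0 ≤ (f : X → ℝ) x) → 0 ≤ L f) ∧
      ∀ u ∈ K, ∀ f : E, (∀ x, (f : X → ℝ) x = (u x).toReal) → L f = (φ u).toReal := by
  have hadd' : ∀ u ∈ K, ∀ v ∈ K, ∀ x, ((u + v) x).toReal = (u x).toReal + (v x).toReal :=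
    fun u hu v hv x => ENNReal.toReal_add (hfin u hu x) (hfin v hv x)
  have φadd' : ∀ u ∈ K, ∀ v ∈ K, (φ (u + v)).toReal = (φ u).toReal + (φ v).toReal :=
    fun u hu v hv => by rw [φadd u hu v hv, ENNReal.toReal_add (φfin u hu) (φfin v hv)]
  obtain ⟨w, hw⟩ := hne
  have h0 : (fun _ => 0 : X → ℝ≥0∞) ∈ K := by simpa using hsmul 0 w hw
  have φ0 : φ (fun _ => 0) = 0 := by simpa using φsmul 0 w hw
  let E : Submodule ℝ (X → ℝ) :=
    { carrier := {f | ∃ u ∈ K, ∀ x, |f x| ≤ (u x).toReal}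
      zero_mem' := ⟨_, h0, fun x => by simp⟩
      add_mem' := by
        rintro f f' ⟨u, hu, hfu⟩ ⟨v, hv, hfv⟩
        refine ⟨u + v, hadd u hu v hv, fun x => ?_⟩
        rw [hadd' u hu v hv]
        exact (abs_add_le _ _).trans (add_le_add (hfu x) (hfv x))
      smul_mem' := by
        rintro c f ⟨u, hu, hfu⟩
        refine ⟨_, hsmul ‖c‖₊ u hu, fun x => ?_⟩
        simpa [abs_mul] using mul_le_mul_of_nonneg_left (hfu x) (abs_nonneg c) }
  -- Graph of the functional u - v ↦ φ u - φ v on differences of cone members. Monotonicity of φ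
  -- makes it positive, and positivity applied to z and -z makes it single-valued.
  let Γ : Submodule ℝ (E × ℝ) :=
    { carrier := {z | ∃ u ∈ K, ∃ v ∈ K,
        (∀ x, (z.1 : X → ℝ) x = (u x).toReal - (v x).toReal) ∧
          z.2 = (φ u).toReal - (φ v).toReal}
      zero_mem' := ⟨_, h0, _, h0, by simp⟩
      add_mem' := by
        rintro z z' ⟨u, hu, v, hv, h1, h2⟩ ⟨u', hu', v', hv', h1', h2'⟩
        refine ⟨u + u', hadd u hu u' hu', v + v', hadd v hv v' hv', fun x => ?_, ?_⟩
        · rw [hadd' u hu u' hu', hadd' v hv v' hv']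
          have := h1 x
          have := h1' x
          simp only [Prod.fst_add, Submodule.coe_add, Pi.add_apply]
          linarith
        · rw [φadd' u hu u' hu', φadd' v hv v' hv', Prod.snd_add]
          linarith
      smul_mem' := by
        rintro c z ⟨u, hu, v, hv, h1, h2⟩
        rcases le_total 0 c with hc | hc
        · refine ⟨_, hsmul ‖c‖₊ u hu, _, hsmul ‖c‖₊ v hv, fun x => ?_, ?_⟩
          · have := h1 x
            simp only [Prod.smul_fst, Submodule.coe_smul, Pi.smul_apply, smul_eq_mul, this,
              ENNReal.toReal_mul, ENNReal.coe_toReal, coe_nnnorm, Real.norm_eq_abs,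
              abs_of_nonneg hc]
            ring
          · rw [φsmul _ u hu, φsmul _ v hv]
            simp only [Prod.smul_snd, smul_eq_mul, h2,
              ENNReal.toReal_mul, ENNReal.coe_toReal, coe_nnnorm, Real.norm_eq_abs,
              abs_of_nonneg hc]
            ring
        · refine ⟨_, hsmul ‖c‖₊ v hv, _, hsmul ‖c‖₊ u hu, fun x => ?_, ?_⟩
          · have := h1 x
            simp only [Prod.smul_fst, Submodule.coe_smul, Pi.smul_apply, smul_eq_mul, this,
              ENNReal.toReal_mul, ENNReal.coe_toReal, coe_nnnorm, Real.norm_eq_abs,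
              abs_of_nonpos hc]
            ring
          · rw [φsmul _ u hu, φsmul _ v hv]
            simp only [Prod.smul_snd, smul_eq_mul, h2,
              ENNReal.toReal_mul, ENNReal.coe_toReal, coe_nnnorm, Real.norm_eq_abs,
              abs_of_nonpos hc]
            ring }
  have hΓpos : ∀ z ∈ Γ, (∀ x, 0 ≤ (z.1 : X → ℝ) x) → 0 ≤ z.2 := by
    rintro z ⟨u, hu, v, hv, h1, h2⟩ hz
    have hvu : v ≤ u := fun x => by
      have := hz x
      rw [h1 x, sub_nonneg] at this
      exact (ENNReal.toReal_le_toReal (hfin v hv x) (hfin u hu x)).1 this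
    rw [h2, sub_nonneg]
    exact ENNReal.toReal_mono (φfin u hu) (φmono v hv u hu hvu)
  have hΓ : ∀ z ∈ Γ, z.1 = 0 → z.2 = 0 := by
    intro z hz hz1
    refine le_antisymm ?_ (hΓpos z hz fun x => by simp [hz1])
    have := hΓpos (-z) (Γ.neg_mem hz) fun x => by simp [hz1]
    simpa using this
  have hval : ∀ (u : X → ℝ≥0∞), u ∈ K → ∀ f : E, (∀ x, (f : X → ℝ) x = (u x).toReal) →
      (f, (φ u).toReal) ∈ Γ := fun u hu f hf =>
    ⟨u, hu, _, h0, fun x => by simp [hf x], by simp [φ0]⟩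
  let s : PointedCone ℝ E :=
    { carrier := {f | ∀ x, 0 ≤ (f : X → ℝ) x}
      zero_mem' := fun x => by simp
      add_mem' := fun {f f'} hf hf' x => by
        simpa using add_nonneg (hf x) (hf' x)
      smul_mem' := fun c f hf x => mul_nonneg c.2 (hf x) }
  -- The extension theorem needs the domain to be cofinal: |f| ≤ u with u in the cone gives u + f ≥
  -- 0.
  obtain ⟨L, hL, hLpos⟩ := riesz_extension s Γ.toLinearPMap
    (fun x hx => hΓpos _ (Submodule.mem_graph_toLinearPMap hΓ x) hx)
    (by
      rintro ⟨f, u, hu, hfu⟩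
      have huE : (fun x => (u x).toReal) ∈ E :=
        ⟨u, hu, fun x => (abs_of_nonneg ENNReal.toReal_nonneg).le⟩
      refine ⟨⟨⟨_, huE⟩, _, hval u hu ⟨_, huE⟩ fun x => rfl, rfl⟩, fun x => ?_⟩
      have := neg_abs_le (f x)
      have := hfu x
      change 0 ≤ (u x).toReal + f x
      linarith)
  refine ⟨E, L, fun f => Iff.rfl, hLpos, fun u hu f hf => ?_⟩
  have hmem := hval u hu f hf
  have hf' : f ∈ Γ.toLinearPMap.domain := ⟨_, hmem, rfl⟩
  rw [hL ⟨f, hf'⟩]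
  have h2 := Submodule.mem_graph_toLinearPMap hΓ ⟨f, hf'⟩
  exact sub_eq_zero.1 (hΓ _ (Γ.sub_mem h2 hmem) (sub_self f))

open CompactlySupported in
/-- A monotone additive functional on a cone of continuous real functions is represented by a
measure on all members which are negligible at infinity with respect to some other member. -/
theorem exists_measure_lintegral_eq {X : Type*} [TopologicalSpace X] [T2Space X]
    [LocallyCompactSpace X] [MeasurableSpace X] [BorelSpace X] (K : Set (X → ℝ≥0∞))
    (hcont : ∀ u ∈ K, IsContReal u) (hadd : ∀ u ∈ K, ∀ v ∈ K, u + v ∈ K)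
    (hsmul : ∀ a : ℝ≥0, ∀ u ∈ K, (fun x => (a : ℝ≥0∞) * u x) ∈ K)
    (hpos : ∃ u ∈ K, ∀ x, 0 < u x)
    (φ : (X → ℝ≥0∞) → ℝ≥0∞) (φfin : ∀ u ∈ K, φ u ≠ ∞)
    (φadd : ∀ u ∈ K, ∀ v ∈ K, φ (u + v) = φ u + φ v)
    (φsmul : ∀ a : ℝ≥0, ∀ u ∈ K, φ (fun x => (a : ℝ≥0∞) * u x) = a * φ u)
    (φmono : ∀ u ∈ K, ∀ v ∈ K, u ≤ v → φ u ≤ φ v) :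
    ∃ μ : Measure X, ∀ p ∈ K, ∀ q ∈ K, (∀ x, 0 < q x) →
      Tendsto (fun x => p x / q x) (cocompact X) (𝓝 0) → ∫⁻ x, p x ∂μ = φ p := by
  obtain ⟨w, hw, hw0⟩ := hpos
  have hreal : ∀ u ∈ K, Continuous fun x => (u x).toReal := fun u hu =>
    ENNReal.continuousOn_toReal.comp_continuous (hcont u hu).1 fun x => (hcont u hu).2 x
  obtain ⟨E, L, hE, hLpos, hL⟩ := exists_positive_extension K (fun u hu => (hcont u hu).2) hadd
    hsmul ⟨w, hw⟩ φ φfin φadd φsmul φmono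
  have hLmono : ∀ f f' : E, (∀ x, (f : X → ℝ) x ≤ (f' : X → ℝ) x) → L f ≤ L f' := by
    intro f f' h
    have := hLpos (f' - f) fun x => by simpa using h x
    simpa using this
  have hCc : ∀ f : C_c(X, ℝ), (f : X → ℝ) ∈ E := by
    intro f
    have hw' : ∀ x, 0 < (w x).toReal := fun x => ENNReal.toReal_pos (hw0 x).ne' ((hcont w hw).2 x)
    have hc : Continuous fun x => f x / (w x).toReal :=
      f.continuous.div (hreal w hw) fun x => (hw' x).ne'
    have hs : HasCompactSupport fun x => f x / (w x).toReal := by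
      refine f.hasCompactSupport.mono fun x hx => ?_
      contrapose! hx
      simp only [Function.mem_support, ne_eq, not_not] at hx ⊢
      simp [hx]
    obtain ⟨M, hM⟩ := hs.exists_bound_of_continuous hc
    refine (hE f).2 ⟨_, hsmul ‖M‖₊ w hw, fun x => ?_⟩
    have := hM x
    rw [norm_div, Real.norm_eq_abs, Real.norm_eq_abs, abs_of_pos (hw' x), div_le_iff₀ (hw' x)] at this
    refine this.trans ?_
    simp only [ENNReal.toReal_mul, ENNReal.coe_toReal, coe_nnnorm]
    exact mul_le_mul_of_nonneg_right (le_abs_self M) (hw' x).le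
  let Λ : C_c(X, ℝ) →ₚ[ℝ] ℝ := PositiveLinearMap.mk₀
    { toFun := fun f => L ⟨f, hCc f⟩
      map_add' := fun f f' => by rw [← map_add]; rfl
      map_smul' := fun a f => by rw [RingHom.id_apply, ← map_smul]; rfl }
    (fun f hf => hLpos _ hf)
  refine ⟨RealRMK.rieszMeasure Λ, fun p hp q hq hq0 hlim => ?_⟩
  have hq' : ∀ x, 0 < (q x).toReal := fun x => ENNReal.toReal_pos (hq0 x).ne' ((hcont q hq).2 x)
  have hmemE : ∀ u ∈ K, (fun x => (u x).toReal) ∈ E := fun u hu =>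
    (hE _).2 ⟨u, hu, fun x => (abs_of_nonneg ENNReal.toReal_nonneg).le⟩
  -- The functions (p - e n * q)⁺ have compact support because p / q vanishes at infinity. They
  -- increase to p, and L of them lies between φ p - e n * φ q and φ p, so no mass is lost at
  -- infinity.
  let e : ℕ → ℝ := fun n => 1 / ((n : ℝ) + 1)
  have he : ∀ n, 0 < e n := fun n => Nat.one_div_pos_of_nat
  have hsupp : ∀ n, HasCompactSupport fun x => max ((p x).toReal - e n * (q x).toReal) 0 := by
    intro n
    have hev : ∀ᶠ x in cocompact X, p x / q x < ENNReal.ofReal (e n) :=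
      hlim.eventually (gt_mem_nhds (ENNReal.ofReal_pos.2 (he n)))
    obtain ⟨t, ht, hts⟩ := mem_cocompact.1 hev
    refine HasCompactSupport.intro ht fun x hx => ?_
    have h := hts hx
    simp only [mem_ofPred_eq] at h
    rw [ENNReal.div_lt_iff (Or.inl (hq0 x).ne') (Or.inl ((hcont q hq).2 x))] at h
    have h' := ENNReal.toReal_mono
      (ENNReal.mul_ne_top ENNReal.ofReal_ne_top ((hcont q hq).2 x)) h.le
    rw [ENNReal.toReal_mul, ENNReal.toReal_ofReal (he n).le] at h'
    exact max_eq_right (by linarith)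
  have hcts : ∀ n, Continuous fun x => max ((p x).toReal - e n * (q x).toReal) 0 := fun n =>
    ((hreal p hp).sub ((hreal q hq).const_mul _)).max continuous_const
  let F : ℕ → C_c(X, ℝ) := fun n => ⟨⟨_, hcts n⟩, hsupp n⟩
  have hF : ∀ n x, F n x = max ((p x).toReal - e n * (q x).toReal) 0 := fun n x => rfl
  have hFint : ∀ n, ∫⁻ x, ENNReal.ofReal (F n x) ∂(RealRMK.rieszMeasure Λ) =
      ENNReal.ofReal (L ⟨F n, hCc (F n)⟩) := by
    intro n
    rw [← ofReal_integral_eq_lintegral_ofReal (f := fun x => F n x)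
      ((F n).continuous.integrable_of_hasCompactSupport
      (F n).hasCompactSupport) (Eventually.of_forall fun x => le_max_right _ _),
      RealRMK.integral_rieszMeasure]
    rfl
  have hLp : L ⟨_, hmemE p hp⟩ = (φ p).toReal := hL p hp _ fun x => rfl
  have hub : ∀ n, L ⟨F n, hCc (F n)⟩ ≤ (φ p).toReal := by
    intro n
    rw [← hLp]
    refine hLmono _ _ fun x => ?_
    have := mul_nonneg (he n).le (hq' x).le
    exact max_le (by linarith) ENNReal.toReal_nonneg
  have hlb : ∀ n, (φ p).toReal - e n * (φ q).toReal ≤ L ⟨F n, hCc (F n)⟩ := by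
    intro n
    rw [← hLp, ← hL q hq ⟨_, hmemE q hq⟩ fun x => rfl, ← smul_eq_mul, ← map_smul, ← map_sub]
    exact hLmono _ _ fun x => le_max_left _ _
  have he0 : Tendsto e atTop (𝓝 0) := tendsto_one_div_add_atTop_nhds_zero_nat
  have hlimL : Tendsto (fun n => ENNReal.ofReal (L ⟨F n, hCc (F n)⟩)) atTop (𝓝 (φ p)) := by
    rw [← ENNReal.ofReal_toReal (φfin p hp)]
    refine ENNReal.tendsto_ofReal (tendsto_of_tendsto_of_tendsto_of_le_of_le ?_
      tendsto_const_nhds hlb hub)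
    simpa using tendsto_const_nhds.sub (he0.mul_const (φ q).toReal)
  have hlimI : Tendsto (fun n => ∫⁻ x, ENNReal.ofReal (F n x) ∂(RealRMK.rieszMeasure Λ)) atTop
      (𝓝 (∫⁻ x, p x ∂(RealRMK.rieszMeasure Λ))) := by
    refine lintegral_tendsto_of_tendsto_of_monotone
      (fun n => (F n).continuous.measurable.ennreal_ofReal.aemeasurable)
      (Eventually.of_forall fun x m n hmn => ENNReal.ofReal_le_ofReal ?_)
      (Eventually.of_forall fun x => ?_)
    · rw [hF, hF]
      have : e n ≤ e m := Nat.one_div_le_one_div hmn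
      exact max_le_max (sub_le_sub_left (mul_le_mul_of_nonneg_right this (hq' x).le) _) le_rfl
    · simp only [hF]
      rw [← ENNReal.ofReal_toReal ((hcont p hp).2 x)]
      refine ENNReal.tendsto_ofReal ?_
      have h : Tendsto (fun n => max ((p x).toReal - e n * (q x).toReal) 0) atTop
          (𝓝 (max ((p x).toReal - 0 * (q x).toReal) 0)) :=
        (tendsto_const_nhds.sub (he0.mul_const _)).max tendsto_const_nhds
      simpa using h
  simp only [hFint] at hlimI
  exact tendsto_nhds_unique hlimI hlimL

/-! ### Elementary properties of reduced functions. -/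

section Reduced

variable {X : Type*} {W : Set (X → ℝ≥0∞)}

theorem reduced_le {A : Set X} {u w : X → ℝ≥0∞} (hw : w ∈ W) (h : ∀ y ∈ A, u y ≤ w y) (x : X) :
    reduced W A u x ≤ w x :=
  iInf₂_le w ⟨hw, h⟩

theorem le_reduced {A : Set X} {u : X → ℝ≥0∞} {x : X} {b : ℝ≥0∞}
    (h : ∀ w ∈ W, (∀ y ∈ A, u y ≤ w y) → b ≤ w x) : b ≤ reduced W A u x :=
  le_iInf₂ fun w hw => h w hw.1 hw.2

theorem reduced_mono {A B : Set X} {u v : X → ℝ≥0∞} (hAB : A ⊆ B) (huv : ∀ y ∈ A, u y ≤ v y)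
    (x : X) : reduced W A u x ≤ reduced W B v x :=
  le_reduced fun _ hw h => reduced_le hw (fun y hy => (huv y hy).trans (h y (hAB hy))) x

theorem le_reduced_of_mem {A : Set X} {u : X → ℝ≥0∞} {x : X} (hx : x ∈ A) :
    u x ≤ reduced W A u x :=
  le_reduced fun _ _ h => h x hx

end Reduced

/-! ### Fine topology, minima, and additivity of reduction. -/

section Cone

variable {X : Type*} [TopologicalSpace X] {W : Set (X → ℝ≥0∞)}

theorem tendsto_fine_of_mem {w : X → ℝ≥0∞} (hw : w ∈ W) (x : X) :
    Tendsto w (@nhds X (fineTopology W) x) (𝓝 (w x)) :=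
  (@Continuous.tendsto _ _ (fineTopology W) _ _
    (continuous_iff_le_induced.2 (inf_le_right.trans (iInf₂_le w hw))) x)

theorem tendsto_fine_of_continuous {w : X → ℝ≥0∞} (hw : Continuous w) (x : X) :
    Tendsto w (@nhds X (fineTopology W) x) (𝓝 (w x)) :=
  (@Continuous.tendsto _ _ (fineTopology W) _ _
    (continuous_iff_le_induced.2 (inf_le_left.trans (continuous_iff_le_induced.1 hw))) x)

theorem fineLscReg_le (f : X → ℝ≥0∞) (x : X) : fineLscReg W f x ≤ f x :=
  liminf_le_of_frequently_le'
    (frequently_iff.2 fun hU => ⟨x, @mem_of_mem_nhds X (fineTopology W) _ _ hU, le_rfl⟩)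

theorem le_fineLscReg {f h : X → ℝ≥0∞} {x : X}
    (hf : Tendsto f (@nhds X (fineTopology W) x) (𝓝 (f x)))
    (hfh : ∀ᶠ y in @nhds X (fineTopology W) x, f y ≤ h y) : f x ≤ fineLscReg W h x := by
  have := @nhds_neBot X (fineTopology W) x
  rw [← hf.liminf_eq]
  exact liminf_le_liminf hfh

namespace IsBalayageSpace

variable (hW : IsBalayageSpace W)
include hW

theorem inf_mem {u v : X → ℝ≥0∞} (hu : u ∈ W) (hv : v ∈ W) : u ⊓ v ∈ W := by
  have h := hW.fineLscReg_mem {u, v} (by rintro w (rfl | rfl) <;> assumption)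
  have he : (fun x => ⨅ w ∈ ({u, v} : Set (X → ℝ≥0∞)), w x) = u ⊓ v := by
    funext x
    rw [iInf_pair]
    rfl
  rw [he] at h
  convert h using 1
  funext x
  refine le_antisymm (le_fineLscReg ?_ (Eventually.of_forall fun _ => le_rfl))
    (fineLscReg_le _ x)
  exact (tendsto_fine_of_mem hu x).min (tendsto_fine_of_mem hv x)

theorem zero_mem : (fun _ => 0 : X → ℝ≥0∞) ∈ W := by
  obtain ⟨u, hu, -⟩ := hW.exists_pos
  simpa using hW.smul_mem 0 u hu

/-- The reduced function of a finely continuous function belongs to the cone. -/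
theorem reduced_univ_mem {f : X → ℝ≥0∞}
    (hf : ∀ x, Tendsto f (@nhds X (fineTopology W) x) (𝓝 (f x))) : reduced W univ f ∈ W := by
  have h := hW.fineLscReg_mem {v | v ∈ W ∧ ∀ y ∈ univ, f y ≤ v y} (fun v hv => hv.1)
  convert h using 1
  funext x
  -- The regularized infimum still majorizes the finely continuous f, so it competes in the infimum
  -- itself.
  refine le_antisymm (reduced_le h (fun y _ => ?_) x) (fineLscReg_le _ x)
  exact le_fineLscReg (hf y) (Eventually.of_forall fun z => le_iInf₂ fun v hv => hv.2 z (mem_univ z))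

/-- If w ≥ u + v on A, Riesz decomposition splits w ⊓ (u + v) into u₁ ≤ u and u₂ ≤ v. On A the sum
is u + v, and finiteness forces u₁ = u and u₂ = v there, so u₁ and u₂ compete for the two reductions
separately. -/
theorem reduced_add {A : Set X} {u v : X → ℝ≥0∞} (hu : u ∈ W) (hv : v ∈ W)
    (hu' : ∀ x, u x ≠ ∞) (hv' : ∀ x, v x ≠ ∞) (x : X) :
    reduced W A (u + v) x = reduced W A u x + reduced W A v x := by
  refine le_antisymm ?_ (le_reduced fun w hw h => ?_)
  · simp only [reduced]
    refine ENNReal.le_iInf₂_add_iInf₂ fun w hw w' hw' => ?_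
    exact reduced_le (hW.add_mem w hw.1 w' hw'.1)
      (fun y hy => add_le_add (hw.2 y hy) (hw'.2 y hy)) x
  · obtain ⟨u₁, hu₁, u₂, hu₂, he, h₁, h₂⟩ := hW.riesz _
      (hW.inf_mem hw (hW.add_mem u hu v hv)) u hu v hv inf_le_right
    have key : ∀ y ∈ A, u y = u₁ y ∧ v y = u₂ y := by
      intro y hy
      have hsum : u y + v y = u₁ y + u₂ y := by
        rw [← Pi.add_apply, ← Pi.add_apply u₁ u₂, ← he]
        exact (min_eq_right (h y hy)).symm
      have e1 : u y = u₁ y := by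
        refine le_antisymm ?_ (h₁ y)
        have : u y + v y ≤ u₁ y + v y := hsum.le.trans (add_le_add le_rfl (h₂ y))
        exact (ENNReal.add_le_add_iff_right (hv' y)).1 this
      refine ⟨e1, ?_⟩
      rw [← e1] at hsum
      exact (ENNReal.add_right_inj (hu' y)).1 hsum
    calc reduced W A u x + reduced W A v x ≤ u₁ x + u₂ x :=
          add_le_add (reduced_le hu₁ (fun y hy => (key y hy).1.le) x)
            (reduced_le hu₂ (fun y hy => (key y hy).2.le) x)
      _ = (w ⊓ (u + v)) x := by rw [he]; rfl
      _ ≤ w x := min_le_left _ _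

theorem reduced_smul {A : Set X} (a : ℝ≥0) (u : X → ℝ≥0∞) (x : X) :
    reduced W A (fun y => (a : ℝ≥0∞) * u y) x = a * reduced W A u x := by
  have key : ∀ (b : ℝ≥0) (v : X → ℝ≥0∞), b ≠ 0 →
      b * reduced W A v x ≤ reduced W A (fun y => (b : ℝ≥0∞) * v y) x := by
    intro b v hb
    refine le_reduced fun w hw h => ?_
    have := reduced_le (A := A) (u := v) (hW.smul_mem b⁻¹ w hw) (fun y hy => by
      rw [ENNReal.coe_inv hb, ← ENNReal.div_eq_inv_mul,
        ENNReal.le_div_iff_mul_le (Or.inl (by simpa using hb)) (Or.inl ENNReal.coe_ne_top),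
        mul_comm]
      exact h y hy) x
    rwa [ENNReal.coe_inv hb, ← ENNReal.div_eq_inv_mul,
        ENNReal.le_div_iff_mul_le (Or.inl (by simpa using hb)) (Or.inl ENNReal.coe_ne_top),
        mul_comm] at this
  rcases eq_or_ne a 0 with rfl | ha
  · simpa using reduced_le (A := A) hW.zero_mem (fun y _ => le_rfl) x
  · refine le_antisymm ?_ (key a u ha)
    have h := key a⁻¹ (fun y => (a : ℝ≥0∞) * u y) (inv_ne_zero ha)
    have ha' : (a : ℝ≥0∞) ≠ 0 := by simpa using ha
    simp only [← mul_assoc, ENNReal.coe_inv ha, ENNReal.inv_mul_cancel ha' ENNReal.coe_ne_top,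
      one_mul] at h
    rw [← ENNReal.div_eq_inv_mul, ENNReal.div_le_iff_le_mul (Or.inl ha')
      (Or.inl ENNReal.coe_ne_top), mul_comm] at h
    exact h

end IsBalayageSpace

theorem IsContReal.add {u v : X → ℝ≥0∞} (hu : IsContReal u) (hv : IsContReal v) :
    IsContReal (u + v) :=
  ⟨hu.1.add hv.1, fun x => ENNReal.add_ne_top.2 ⟨hu.2 x, hv.2 x⟩⟩

theorem IsContReal.smul {u : X → ℝ≥0∞} (hu : IsContReal u) (a : ℝ≥0) :
    IsContReal fun x => (a : ℝ≥0∞) * u x :=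
  ⟨(ENNReal.continuous_const_mul ENNReal.coe_ne_top).comp hu.1,
    fun x => ENNReal.mul_ne_top ENNReal.coe_ne_top (hu.2 x)⟩

theorem IsContReal.inf {u v : X → ℝ≥0∞} (hu : IsContReal u) (hv : IsContReal v) :
    IsContReal (u ⊓ v) :=
  ⟨hu.1.inf hv.1, fun x => ne_top_of_le_ne_top (hu.2 x) inf_le_left⟩

theorem IsContReal.sub {u v : X → ℝ≥0∞} (hu : IsContReal u) (hv : IsContReal v) :
    IsContReal (u - v) :=
  ⟨continuous_iff_continuousAt.2 fun x =>
      ENNReal.Tendsto.sub (hu.1.tendsto x) (hv.1.tendsto x) (Or.inl (hu.2 x)),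
    fun x => ENNReal.sub_ne_top (hu.2 x)⟩

/-- Lower semicontinuous summands of a continuous real function are continuous. -/
theorem continuous_of_add_eq {u v w : X → ℝ≥0∞} (hv : LowerSemicontinuous v)
    (hw : LowerSemicontinuous w) (hu : IsContReal u) (h : u = v + w) : Continuous v := by
  refine continuous_iff_lower_upperSemicontinuous.2 ⟨hv, fun x b hb => ?_⟩
  have hx : u x = v x + w x := congrFun h x
  have hwx : w x ≠ ∞ := fun h => hu.2 x (by rw [hx, h, add_top])
  rcases eq_or_ne (w x) 0 with h0 | h0
  · have : u x < b := by rwa [hx, h0, add_zero]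
    filter_upwards [hu.1.tendsto x (gt_mem_nhds this)] with y hy
    have hy' : v y ≤ u y := by rw [h]; exact le_self_add
    exact hy'.trans_lt hy
  -- With u x - b < d < w x, near x both u < b + d and w > d hold, hence v < b.
  · have hlt : u x - b < w x := by
      rcases le_total b (u x) with hbu | hbu
      · exact ENNReal.sub_lt_of_lt_add hbu (by
          rw [hx, add_comm (w x)]; exact ENNReal.add_lt_add_right hwx hb)
      · rw [tsub_eq_zero_of_le hbu]; exact pos_iff_ne_zero.2 h0
    obtain ⟨d, hd1, hd2⟩ := exists_between hlt
    have hux : u x < b + d := by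
      by_contra! hcon
      have hb' : b ≠ ∞ := ne_top_of_le_ne_top (hu.2 x) (le_self_add.trans hcon)
      exact absurd hd1 (not_lt.2 (ENNReal.le_sub_of_add_le_left hb' hcon))
    filter_upwards [hu.1.tendsto x (gt_mem_nhds hux), hw x d hd2] with y hy1 hy2
    have hy : v y + w y < b + d := by
      have := congrFun h y
      rw [← Pi.add_apply, ← this]; exact hy1
    by_contra! hcon
    exact absurd hy (not_lt.2 (add_le_add hcon hy2.le))

/-- Riesz decomposition of u ≤ R + v, where R is the reduction of u - v, gives u = u₁ + u₂ with u₁ ≤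
R and u₂ ≤ v. Then u₁ ≥ u - v, so u₁ = R: thus R is a summand of the continuous u. -/
theorem IsBalayageSpace.reduced_univ_sub_mem (hW : IsBalayageSpace W) {u v : X → ℝ≥0∞}
    (hu : u ∈ W) (hv : v ∈ W) (hu' : IsContReal u) (hv' : IsContReal v) :
    reduced W univ (u - v) ∈ W ∧ IsContReal (reduced W univ (u - v)) := by
  have hmem := hW.reduced_univ_mem (fun x => tendsto_fine_of_continuous (W := W) (hu'.sub hv').1 x)
  have hle : reduced W univ (u - v) ≤ u := fun x => reduced_le hu (fun y _ => tsub_le_self) x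
  refine ⟨hmem, ?_, fun x => ne_top_of_le_ne_top (hu'.2 x) (hle x)⟩
  obtain ⟨u₁, hu₁, u₂, hu₂, he, h₁, h₂⟩ := hW.riesz u hu _ hmem v hv
    (fun x => tsub_le_iff_right.1 (le_reduced_of_mem (u := u - v) (mem_univ x)))
  have : u₁ = reduced W univ (u - v) := by
    refine le_antisymm h₁ fun x => reduced_le hu₁ (fun y _ => ?_) x
    rw [Pi.sub_apply, congrFun he y]
    exact tsub_le_iff_right.2 (add_le_add le_rfl (h₂ y))
  rw [← this]
  exact continuous_of_add_eq (hW.lsc _ hu₁) (hW.lsc _ hu₂) hu' he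

end Cone

/-! ### Existence of reduced measures. -/

/-- Reduced measures exist. -/
theorem IsBalayageSpace.isReducedMeasure_reducedMeasure {X : Type*} [TopologicalSpace X]
    [T2Space X] [LocallyCompactSpace X] [MeasurableSpace X] [BorelSpace X] {W : Set (X → ℝ≥0∞)}
    (hW : IsBalayageSpace W) (A : Set X) (x : X) :
    IsReducedMeasure W A x (reducedMeasure W A x) := by
  have hex : ∃ μ : Measure X, IsReducedMeasure W A x μ := by
    obtain ⟨w, hw, -, -, hwc, -, hw0, -⟩ := hW.exists_pos
    obtain ⟨μ, hμ⟩ := exists_measure_lintegral_eq {u | u ∈ W ∧ IsContReal u} (fun u hu => hu.2)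
      (fun u hu v hv => ⟨hW.add_mem u hu.1 v hv.1, hu.2.add hv.2⟩)
      (fun a u hu => ⟨hW.smul_mem a u hu.1, hu.2.smul a⟩) ⟨w, ⟨hw, hwc⟩, hw0⟩
      (fun u => reduced W A u x)
      (fun u hu => ne_top_of_le_ne_top (hu.2.2 x) (reduced_le hu.1 (fun _ _ => le_rfl) x))
      (fun u hu v hv => hW.reduced_add hu.1 hv.1 hu.2.2 hv.2.2 x)
      (fun a u _ => hW.reduced_smul a u x)
      (fun u _ v _ huv => reduced_mono subset_rfl (fun y _ => huv y) x)
    refine ⟨μ, fun p hp => ?_⟩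
    obtain ⟨hpW, hpc, q, hq, hqc, hq0, hlim⟩ := hp
    exact hμ p ⟨hpW, hpc⟩ q ⟨hq, hqc⟩ hq0 hlim
  rw [reducedMeasure, dif_pos hex]
  exact hex.choose_spec

/-! ### Differences of continuous potentials as test functions. -/

section Differences

variable {X : Type*} [TopologicalSpace X] {W : Set (X → ℝ≥0∞)} {p₀ : X → ℝ≥0∞}

/-- The continuous real functions in `W` which are dominated by a multiple of `p₀`. -/
def dominatedCone (W : Set (X → ℝ≥0∞)) (p₀ : X → ℝ≥0∞) : Set (X → ℝ≥0∞) :=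
  {p | p ∈ W ∧ IsContReal p ∧ ∃ b : ℝ≥0, ∀ x, p x ≤ b * p₀ x}

/-- The positive parts of differences of functions in `dominatedCone W p₀`. -/
def posDifferences (W : Set (X → ℝ≥0∞)) (p₀ : X → ℝ≥0∞) : Set (X → ℝ≥0∞) :=
  {f | ∃ u ∈ dominatedCone W p₀, ∃ v ∈ dominatedCone W p₀, f = u - v}

theorem self_mem_dominatedCone (h : p₀ ∈ contPotentials W) : p₀ ∈ dominatedCone W p₀ :=
  ⟨h.1, h.2.1, 1, fun x => by simp⟩

theorem isContReal_of_mem_posDifferences {f : X → ℝ≥0∞} (hf : f ∈ posDifferences W p₀) :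
    IsContReal f := by
  obtain ⟨u, hu, v, hv, rfl⟩ := hf
  exact hu.2.1.sub hv.2.1

theorem dominatedCone_subset_contPotentials (h : p₀ ∈ contPotentials W) :
    dominatedCone W p₀ ⊆ contPotentials W := by
  rintro p ⟨hp, hpc, b, hb⟩
  obtain ⟨-, -, q, hq, hqc, hq0, hlim⟩ := h
  refine ⟨hp, hpc, q, hq, hqc, hq0, ?_⟩
  have h2 : Tendsto (fun x => (b : ℝ≥0∞) * (p₀ x / q x)) (cocompact X) (𝓝 0) := by
    simpa using ENNReal.Tendsto.const_mul hlim (Or.inr ENNReal.coe_ne_top)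
  refine tendsto_of_tendsto_of_tendsto_of_le_of_le tendsto_const_nhds h2 (fun _ => zero_le)
    fun x => ?_
  change p x / q x ≤ b * (p₀ x / q x)
  rw [← mul_div_assoc]
  exact ENNReal.div_le_div_right (hb x) _

/-- Both differences are brought to the subtrahend b + d, and the maximum is written as sum minus
minimum, since the cone is stable under minima only. -/
theorem ennreal_sup_sub_sub {a b c d : ℝ≥0∞} (ha : a ≠ ∞) (hb : b ≠ ∞) (hc : c ≠ ∞) (hd : d ≠ ∞) :
    (a - b) ⊔ (c - d) = (a + d) + (c + b) - ((a + d) ⊓ (c + b) + (b + d)) := by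
  lift a to ℝ≥0 using ha
  lift b to ℝ≥0 using hb
  lift c to ℝ≥0 using hc
  lift d to ℝ≥0 using hd
  norm_cast
  apply NNReal.eq
  push_cast [NNReal.coe_sub_def]
  grind

theorem ennreal_inf_sub_sub {a b c d : ℝ≥0∞} (ha : a ≠ ∞) (hb : b ≠ ∞) (hc : c ≠ ∞) (hd : d ≠ ∞) :
    (a - b) ⊓ (c - d) = (a + d) ⊓ (c + b) - (b + d) := by
  lift a to ℝ≥0 using ha
  lift b to ℝ≥0 using hb
  lift c to ℝ≥0 using hc
  lift d to ℝ≥0 using hd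
  norm_cast
  apply NNReal.eq
  push_cast [NNReal.coe_sub_def]
  grind

namespace IsBalayageSpace

variable (hW : IsBalayageSpace W)
include hW

theorem add_mem_dominatedCone {u v : X → ℝ≥0∞} (hu : u ∈ dominatedCone W p₀)
    (hv : v ∈ dominatedCone W p₀) : u + v ∈ dominatedCone W p₀ := by
  obtain ⟨hu, huc, b, hb⟩ := hu
  obtain ⟨hv, hvc, d, hd⟩ := hv
  refine ⟨hW.add_mem u hu v hv, huc.add hvc, b + d, fun x => ?_⟩
  rw [ENNReal.coe_add, add_mul]
  exact add_le_add (hb x) (hd x)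

theorem smul_mem_dominatedCone (a : ℝ≥0) {u : X → ℝ≥0∞} (hu : u ∈ dominatedCone W p₀) :
    (fun x => (a : ℝ≥0∞) * u x) ∈ dominatedCone W p₀ := by
  obtain ⟨hu, huc, b, hb⟩ := hu
  refine ⟨hW.smul_mem a u hu, huc.smul a, a * b, fun x => ?_⟩
  rw [ENNReal.coe_mul, mul_assoc]
  exact mul_le_mul_right (hb x) _

theorem inf_mem_dominatedCone {u v : X → ℝ≥0∞} (hu : u ∈ dominatedCone W p₀)
    (hv : v ∈ W) (hv' : IsContReal v) : u ⊓ v ∈ dominatedCone W p₀ := by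
  obtain ⟨hu, huc, b, hb⟩ := hu
  exact ⟨hW.inf_mem hu hv, huc.inf hv', b, fun x => inf_le_left.trans (hb x)⟩

theorem zero_mem_dominatedCone : (fun _ => 0 : X → ℝ≥0∞) ∈ dominatedCone W p₀ :=
  ⟨hW.zero_mem, ⟨continuous_const, by simp⟩, 0, by simp⟩

theorem mem_posDifferences {u : X → ℝ≥0∞} (hu : u ∈ dominatedCone W p₀) :
    u ∈ posDifferences W p₀ :=
  ⟨u, hu, _, hW.zero_mem_dominatedCone, by funext x; simp⟩

theorem sup_mem_posDifferences {f h : X → ℝ≥0∞} (hf : f ∈ posDifferences W p₀)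
    (hh : h ∈ posDifferences W p₀) : f ⊔ h ∈ posDifferences W p₀ := by
  obtain ⟨u, hu, v, hv, rfl⟩ := hf
  obtain ⟨u', hu', v', hv', rfl⟩ := hh
  have h1 := hW.add_mem_dominatedCone hu hv'
  have h2 := hW.add_mem_dominatedCone hu' hv
  exact ⟨_, hW.add_mem_dominatedCone h1 h2, _,
    hW.add_mem_dominatedCone (hW.inf_mem_dominatedCone h1 h2.1 h2.2.1)
      (hW.add_mem_dominatedCone hv hv'),
    funext fun x => ennreal_sup_sub_sub (hu.2.1.2 x) (hv.2.1.2 x) (hu'.2.1.2 x) (hv'.2.1.2 x)⟩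

theorem inf_mem_posDifferences {f h : X → ℝ≥0∞} (hf : f ∈ posDifferences W p₀)
    (hh : h ∈ posDifferences W p₀) : f ⊓ h ∈ posDifferences W p₀ := by
  obtain ⟨u, hu, v, hv, rfl⟩ := hf
  obtain ⟨u', hu', v', hv', rfl⟩ := hh
  have h1 := hW.add_mem_dominatedCone hu hv'
  have h2 := hW.add_mem_dominatedCone hu' hv
  exact ⟨_, hW.inf_mem_dominatedCone h1 h2.1 h2.2.1, _, hW.add_mem_dominatedCone hv hv',
    funext fun x => ennreal_inf_sub_sub (hu.2.1.2 x) (hv.2.1.2 x) (hu'.2.1.2 x) (hv'.2.1.2 x)⟩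

theorem smul_mem_posDifferences (a : ℝ≥0) {f : X → ℝ≥0∞} (hf : f ∈ posDifferences W p₀) :
    (fun x => (a : ℝ≥0∞) * f x) ∈ posDifferences W p₀ := by
  obtain ⟨u, hu, v, hv, rfl⟩ := hf
  exact ⟨_, hW.smul_mem_dominatedCone a hu, _, hW.smul_mem_dominatedCone a hv,
    funext fun x => ENNReal.mul_sub fun _ _ => ENNReal.coe_ne_top⟩

theorem reduced_univ_mem_dominatedCone {f : X → ℝ≥0∞} (hf : f ∈ posDifferences W p₀) :
    reduced W univ f ∈ dominatedCone W p₀ := by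
  obtain ⟨u, ⟨hu, huc, b, hb⟩, v, ⟨hv, hvc, -⟩, rfl⟩ := hf
  obtain ⟨h1, h2⟩ := hW.reduced_univ_sub_mem hu hv huc hvc
  exact ⟨h1, h2, b, fun x => (reduced_le hu (fun y _ => tsub_le_self) x).trans (hb x)⟩

/-- Truncating v at b * p₀ with b large does not change it at x and y. So if all quotients agreed,
every continuous v in `W`, and by `eq_sup` every w, would satisfy w x = (p₀ x / p₀ y) * w y, against
linear separation. -/
theorem exists_div_ne (h₀ : p₀ ∈ contPotentials W) (hpos : ∀ x, 0 < p₀ x) {x y : X} (hxy : x ≠ y) :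
    ∃ p ∈ dominatedCone W p₀, p x / p₀ x ≠ p y / p₀ y := by
  by_contra! hcon
  have hfin := h₀.2.1.2
  have ha : p₀ x / p₀ y ≠ ∞ := ENNReal.div_ne_top (hfin x) (hpos y).ne'
  have key : ∀ v ∈ W, IsContReal v → v x = p₀ x / p₀ y * v y := by
    intro v hv hvc
    have hb : v x / p₀ x + v y / p₀ y ≠ ∞ := ENNReal.add_ne_top.2
      ⟨ENNReal.div_ne_top (hvc.2 x) (hpos x).ne', ENNReal.div_ne_top (hvc.2 y) (hpos y).ne'⟩
    obtain ⟨b, hb⟩ : ∃ b : ℝ≥0, (b : ℝ≥0∞) = v x / p₀ x + v y / p₀ y :=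
      ⟨_, ENNReal.coe_toNNReal hb⟩
    have h1 : v x ≤ b * p₀ x :=
      (ENNReal.div_le_iff (hpos x).ne' (hfin x)).1 (hb ▸ le_self_add)
    have h2 : v y ≤ b * p₀ y :=
      (ENNReal.div_le_iff (hpos y).ne' (hfin y)).1 (hb ▸ le_add_self)
    have h3 := hcon _ (hW.inf_mem_dominatedCone
      (hW.smul_mem_dominatedCone b (self_mem_dominatedCone h₀)) hv hvc)
    simp only [Pi.inf_apply, inf_eq_right.2 h1, inf_eq_right.2 h2] at h3
    rw [← ENNReal.div_mul_cancel (hpos x).ne' (hfin x) (b := v x), h3, div_eq_mul_inv,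
      div_eq_mul_inv]
    ring
  obtain ⟨w, hw, hne⟩ := hW.separates x y hxy (p₀ x / p₀ y).toNNReal
  rw [ENNReal.coe_toNNReal ha] at hne
  refine hne ?_
  rw [hW.eq_sup w hw x, hW.eq_sup w hw y]
  simp only [ENNReal.mul_iSup]
  exact iSup_congr fun v => iSup_congr fun hv => key v hv.1 hv.2.1

theorem exists_dominatedCone_lt_lt (h₀ : p₀ ∈ contPotentials W) (hpos : ∀ x, 0 < p₀ x) {x y : X}
    (hxy : x ≠ y) :
    ∃ u ∈ dominatedCone W p₀, ∃ v ∈ dominatedCone W p₀, v x < u x ∧ u y < v y := by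
  have hfin := h₀.2.1.2
  obtain ⟨p, hp, hne⟩ := hW.exists_div_ne h₀ hpos hxy
  rcases lt_or_gt_of_ne hne with h | h
  · obtain ⟨b, hb1, hb2⟩ := ENNReal.lt_iff_exists_nnreal_btwn.1 h
    refine ⟨_, hW.smul_mem_dominatedCone b (self_mem_dominatedCone h₀), p, hp, ?_, ?_⟩
    · exact (ENNReal.div_lt_iff (Or.inl (hpos x).ne') (Or.inl (hfin x))).1 hb1
    · exact (ENNReal.lt_div_iff_mul_lt (Or.inl (hpos y).ne') (Or.inl (hfin y))).1 hb2
  · obtain ⟨b, hb1, hb2⟩ := ENNReal.lt_iff_exists_nnreal_btwn.1 h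
    refine ⟨p, hp, _, hW.smul_mem_dominatedCone b (self_mem_dominatedCone h₀), ?_, ?_⟩
    · exact (ENNReal.lt_div_iff_mul_lt (Or.inl (hpos x).ne') (Or.inl (hfin x))).1 hb2
    · exact (ENNReal.div_lt_iff (Or.inl (hpos y).ne') (Or.inl (hfin y))).1 hb1

/-- Each point of K has a neighbourhood on which some difference positive at x vanishes; compactness
and finite minima do the rest. -/
theorem exists_posDifferences_pos_of_isCompact (h₀ : p₀ ∈ contPotentials W)
    (hpos : ∀ x, 0 < p₀ x) {K : Set X} (hK : IsCompact K) {x : X} (hx : x ∉ K) :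
    ∃ f ∈ posDifferences W p₀, 0 < f x ∧ ∀ y ∈ K, f y = 0 := by
  refine hK.induction_on (p := fun S => ∃ f ∈ posDifferences W p₀, 0 < f x ∧ ∀ y ∈ S, f y = 0)
    ⟨p₀, hW.mem_posDifferences (self_mem_dominatedCone h₀), hpos x, by simp⟩ ?_ ?_ ?_
  · rintro S T hST ⟨f, hf, hfx, hf0⟩
    exact ⟨f, hf, hfx, fun y hy => hf0 y (hST hy)⟩
  · rintro S T ⟨f, hf, hfx, hf0⟩ ⟨h, hh, hhx, hh0⟩
    refine ⟨f ⊓ h, hW.inf_mem_posDifferences hf hh, lt_min hfx hhx, ?_⟩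
    rintro y (hy | hy)
    · simp [hf0 y hy]
    · simp [hh0 y hy]
  · intro y hy
    obtain ⟨u, hu, v, hv, h1, h2⟩ := hW.exists_dominatedCone_lt_lt h₀ hpos
      (ne_of_mem_of_not_mem hy hx).symm
    refine ⟨{z | u z < v z}, mem_nhdsWithin_of_mem_nhds
      ((isOpen_lt hu.2.1.1 hv.2.1.1).mem_nhds h2), u - v, ⟨u, hu, v, hv, rfl⟩,
      tsub_pos_of_lt h1, fun z hz => tsub_eq_zero_of_le (le_of_lt hz)⟩

/-- The sets `{f > 0}`, where `f` is a positive part of a difference of continuous potentials,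
form a base of the topology. -/
theorem exists_posDifferences_pos (h₀ : p₀ ∈ contPotentials W) (hpos : ∀ x, 0 < p₀ x)
    {U : Set X} (hU : IsOpen U) {x : X} (hx : x ∈ U) :
    ∃ f ∈ posDifferences W p₀, 0 < f x ∧ ∀ y ∉ U, f y = 0 := by
  obtain ⟨-, -, q, hq, hqc, hq0, hlim⟩ := id h₀
  have hfin := h₀.2.1.2
  obtain ⟨e, he1, he2⟩ := ENNReal.lt_iff_exists_nnreal_btwn.1
    (ENNReal.div_pos (hpos x).ne' (hqc.2 x))
  obtain ⟨t, ht, hts⟩ := mem_cocompact.1 (hlim.eventually (gt_mem_nhds he1))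
  obtain ⟨f, hf, hfx, hf0⟩ := hW.exists_posDifferences_pos_of_isCompact h₀ hpos
    (ht.diff hU) (x := x) (fun h => h.2 hx)
  have hself := self_mem_dominatedCone h₀
  -- The second factor of the minimum vanishes off the compact t, where p₀ < e * q, and is positive
  -- at x since e < p₀ x / q x; f takes care of t \ U.
  refine ⟨f ⊓ (p₀ - p₀ ⊓ fun z => (e : ℝ≥0∞) * q z), hW.inf_mem_posDifferences hf
    ⟨_, hself, _, hW.inf_mem_dominatedCone hself (hW.smul_mem e q hq) (hqc.smul e), rfl⟩,
    lt_min hfx (tsub_pos_of_lt (min_lt_of_right_lt ?_)), fun y hy => ?_⟩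
  · exact (ENNReal.lt_div_iff_mul_lt (Or.inl (hq0 x).ne') (Or.inl (hqc.2 x))).1 he2
  · by_cases hyt : y ∈ t
    · simp [hf0 y ⟨hyt, hy⟩]
    · have h1 : p₀ y / q y < e := hts hyt
      have h2 := (ENNReal.div_lt_iff (Or.inl (hq0 y).ne') (Or.inl (hqc.2 y))).1 h1
      simp [min_eq_left h2.le]

/-- On an open set a function of `dominatedCone W p₀` is an increasing limit of functions in
`posDifferences W p₀` which vanish outside. -/
theorem exists_posDifferences_monotone [SecondCountableTopology X] (h₀ : p₀ ∈ contPotentials W)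
    (hpos : ∀ x, 0 < p₀ x) {U : Set X} (hU : IsOpen U) {q : X → ℝ≥0∞}
    (hq : q ∈ dominatedCone W p₀) :
    ∃ f : ℕ → X → ℝ≥0∞, (∀ n, f n ∈ posDifferences W p₀) ∧ Monotone f ∧
      (∀ n, ∀ x ∉ U, f n x = 0) ∧ (∀ n x, f n x ≤ q x) ∧ ∀ x ∈ U, ⨆ n, f n x = q x := by
  let ι := {f : X → ℝ≥0∞ // f ∈ posDifferences W p₀ ∧ ∀ y ∉ U, f y = 0}
  let z : ι := ⟨_, hW.mem_posDifferences hW.zero_mem_dominatedCone, fun _ _ => rfl⟩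
  obtain ⟨T, hT, hTU⟩ := TopologicalSpace.isOpen_iUnion_countable
    (fun f : ι => {x | 0 < f.1 x})
    (fun f => isOpen_lt continuous_const (isContReal_of_mem_posDifferences f.2.1).1)
  -- Inserting the zero function z guarantees a nonempty family to enumerate, even if U is empty.
  obtain ⟨h, hh⟩ := (hT.insert z).exists_eq_range (insert_nonempty z T)
  have hcov : ∀ x ∈ U, ∃ k, 0 < (h k).1 x := by
    intro x hx
    obtain ⟨f, hf, hfx, hf0⟩ := hW.exists_posDifferences_pos h₀ hpos hU hx
    have : x ∈ ⋃ f : ι, {x | 0 < f.1 x} := mem_iUnion.2 ⟨⟨f, hf, hf0⟩, hfx⟩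
    rw [← hTU] at this
    obtain ⟨f', hf', hx'⟩ := mem_iUnion₂.1 this
    obtain ⟨k, rfl⟩ : f' ∈ range h := hh ▸ mem_insert_of_mem z hf'
    exact ⟨k, hx'⟩
  let s := partialSups fun n => (h n).1
  have hs : ∀ n, s n ∈ posDifferences W p₀ ∧ ∀ y ∉ U, s n y = 0 := by
    intro n
    induction n with
    | zero => simpa [s] using (h 0).2
    | succ n ih =>
      have : s (n + 1) = s n ⊔ (h (n + 1)).1 := partialSups_add_one _ n
      rw [this]
      exact ⟨hW.sup_mem_posDifferences ih.1 (h (n + 1)).2.1, fun y hy => by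
        simp [ih.2 y hy, (h (n + 1)).2.2 y hy]⟩
  refine ⟨fun n => (fun x => ((n : ℝ≥0) : ℝ≥0∞) * s n x) ⊓ q, fun n => ?_, fun m n hmn x => ?_,
    fun n x hx => by simp [(hs n).2 x hx], fun n x => inf_le_right, fun x hx => ?_⟩
  · exact hW.inf_mem_posDifferences (hW.smul_mem_posDifferences n (hs n).1)
      (hW.mem_posDifferences hq)
  · refine inf_le_inf (mul_le_mul' ?_ (s.monotone hmn x)) le_rfl
    simpa using hmn
  · refine le_antisymm (iSup_le fun n => inf_le_right) ?_
    obtain ⟨k, hk⟩ := hcov x hx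
    obtain ⟨n, hn⟩ := ENNReal.exists_nat_mul_gt hk.ne' (hq.2.1.2 x)
    refine le_iSup_of_le (max k n) (le_inf (hn.le.trans (mul_le_mul' ?_ ?_)) le_rfl)
    · simp
    · exact le_partialSups_of_le (fun n => (h n).1) (le_max_left k n) x

/-- The reduced function of a continuous potential on an open set is an increasing limit of
reduced functions which are continuous. -/
theorem exists_reduced_isOpen_eq_iSup [SecondCountableTopology X] (h₀ : p₀ ∈ contPotentials W)
    (hpos : ∀ x, 0 < p₀ x) {U : Set X} (hU : IsOpen U) {q : X → ℝ≥0∞}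
    (hq : q ∈ dominatedCone W p₀) :
    ∃ f : ℕ → X → ℝ≥0∞, (∀ n, f n ∈ posDifferences W p₀) ∧ Monotone f ∧
      (∀ n, ∀ x ∉ U, f n x = 0) ∧ ∀ x, reduced W U q x = ⨆ n, reduced W univ (f n) x := by
  obtain ⟨f, hf, hmono, hf0, hfq, hsup⟩ := hW.exists_posDifferences_monotone h₀ hpos hU hq
  refine ⟨f, hf, hmono, hf0, fun x => le_antisymm ?_ (iSup_le fun n => ?_)⟩
  · refine reduced_le (hW.iSup_mem (fun n => reduced W univ (f n))
      (fun n => (hW.reduced_univ_mem_dominatedCone (hf n)).1)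
      (fun m n hmn => reduced_mono subset_rfl fun y _ => hmono hmn y)) (fun y hy => ?_) x
    rw [← hsup y hy]
    exact iSup_mono fun n => le_reduced_of_mem (mem_univ y)
  · refine le_reduced fun w hw hwq => reduced_le hw (fun y _ => ?_) x
    by_cases hy : y ∈ U
    · exact (hfq n y).trans (hwq y hy)
    · simp [hf0 n y hy]

/-- If w ≥ p on A, then w + d * p₀ > p on an open neighbourhood of A by lower semicontinuity, and d
is chosen so that d * p₀ x = ε. -/
theorem iInf_reduced_isOpen_le (h₀ : p₀ ∈ contPotentials W) (hpos : ∀ x, 0 < p₀ x) {A B : Set X}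
    (hAB : A ⊆ interior B) {p : X → ℝ≥0∞} (hp : IsContReal p) (x : X) :
    ⨅ U ∈ {U : Set X | IsOpen U ∧ A ⊆ U ∧ U ⊆ B}, reduced W U p x ≤ reduced W A p x := by
  refine le_reduced fun w hw hwp => ?_
  refine ENNReal.le_of_forall_pos_le_add fun ε hε _ => ?_
  have hfin := h₀.2.1.2
  have hδ : (ε : ℝ≥0∞) / p₀ x ≠ ∞ := ENNReal.div_ne_top ENNReal.coe_ne_top (hpos x).ne'
  have hδ0 : 0 < (ε : ℝ≥0∞) / p₀ x := ENNReal.div_pos (by simpa using hε.ne') (hfin x)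
  obtain ⟨d, hd⟩ : ∃ d : ℝ≥0, (d : ℝ≥0∞) = ε / p₀ x := ⟨_, ENNReal.coe_toNNReal hδ⟩
  have hmem := hW.add_mem w hw _ (hW.smul_mem d p₀ h₀.1)
  have hlsc := hW.lsc _ hmem
  let V := {y | p y < (w + fun y => (d : ℝ≥0∞) * p₀ y) y}
  have hV : IsOpen V := by
    refine isOpen_iff_mem_nhds.2 fun y hy => ?_
    obtain ⟨b, hb1, hb2⟩ := exists_between (show p y < _ from hy)
    filter_upwards [hp.1.tendsto y (gt_mem_nhds hb1), hlsc y b hb2] with z h1 h2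
    exact lt_trans h1 h2
  have hAV : A ⊆ V := fun y hy => by
    have h1 : p y ≤ w y := hwp y hy
    refine (ENNReal.lt_add_right (hp.2 y) ?_).trans_le (add_le_add h1 le_rfl)
    exact mul_ne_zero (by rw [hd]; exact hδ0.ne') (hpos y).ne'
  refine (iInf₂_le (V ∩ interior B) ⟨hV.inter isOpen_interior, subset_inter hAV hAB,
    inter_subset_right.trans interior_subset⟩).trans ?_
  refine (reduced_le hmem (fun y hy => le_of_lt hy.1) x).trans ?_
  change w x + d * p₀ x ≤ w x + ε
  rw [hd, ENNReal.div_mul_cancel (hpos x).ne' (hfin x)]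

end IsBalayageSpace

end Differences

/-! ### Comparison of reduced measures. -/

section Measures

variable {X : Type*} [MetricSpace X] [SecondCountableTopology X] [MeasurableSpace X] [BorelSpace X]
  {W : Set (X → ℝ≥0∞)} {p₀ : X → ℝ≥0∞}

namespace IsBalayageSpace

variable (hW : IsBalayageSpace W)
include hW

/-- Comparison of measures by their integrals of positive parts of differences of potentials. -/
theorem measure_le_of_forall_posDifferences (h₀ : p₀ ∈ contPotentials W) (hpos : ∀ x, 0 < p₀ x)
    {μ ν : Measure X} (hν : ∫⁻ x, p₀ x ∂ν ≠ ∞)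
    (h : ∀ f ∈ posDifferences W p₀, ∫⁻ x, f x ∂μ ≤ ∫⁻ x, f x ∂ν) : μ ≤ ν := by
  have hmeas : Measurable p₀ := h₀.2.1.1.measurable
  -- Weighting by p₀ makes ν finite, hence outer regular, so an inequality on open sets extends to
  -- Borel sets; the weight is divided out at the end.
  have hopen : ∀ U, IsOpen U → μ.withDensity p₀ U ≤ ν.withDensity p₀ U := by
    intro U hU
    obtain ⟨f, hf, hmono, hf0, hfq, hsup⟩ :=
      hW.exists_posDifferences_monotone h₀ hpos hU (self_mem_dominatedCone h₀)
    have hind : U.indicator p₀ = fun x => ⨆ n, f n x := by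
      funext x
      by_cases hx : x ∈ U
      · rw [indicator_of_mem hx, hsup x hx]
      · simp [indicator_of_notMem hx, hf0 _ x hx]
    have hfm : ∀ n, Measurable (f n) := fun n =>
      (isContReal_of_mem_posDifferences (hf n)).1.measurable
    rw [withDensity_apply _ hU.measurableSet, withDensity_apply _ hU.measurableSet,
      ← lintegral_indicator hU.measurableSet, ← lintegral_indicator hU.measurableSet, hind,
      lintegral_iSup hfm hmono, lintegral_iSup hfm hmono]
    exact iSup_mono fun n => h _ (hf n)
  have hfinite : IsFiniteMeasure (ν.withDensity p₀) := isFiniteMeasure_withDensity hν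
  have hle : μ.withDensity p₀ ≤ ν.withDensity p₀ := by
    refine Measure.le_iff.2 fun E _ => ?_
    rw [E.measure_eq_iInf_isOpen (ν.withDensity p₀)]
    exact le_iInf₂ fun U hEU => le_iInf fun hU => (measure_mono hEU).trans (hopen U hU)
  have hinv : ∀ κ : Measure X, (κ.withDensity p₀).withDensity p₀⁻¹ = κ := fun κ =>
    withDensity_inv_same hmeas (Eventually.of_forall fun x => (hpos x).ne')
      (Eventually.of_forall fun x => h₀.2.1.2 x)
  rw [← hinv μ, ← hinv ν]
  refine Measure.le_iff.2 fun E hE => ?_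
  rw [withDensity_apply _ hE, withDensity_apply _ hE]
  exact lintegral_mono' (Measure.restrict_mono subset_rfl hle) le_rfl

/-- R_q^U is an increasing limit of continuous potentials R_f with f = 0 off U ⊆ A. A member of `W`
above R_f on A is above f everywhere, hence above R_f, so reducing R_f on A changes nothing. -/
theorem lintegral_reduced_isOpen (h₀ : p₀ ∈ contPotentials W) (hpos : ∀ x, 0 < p₀ x)
    {U A : Set X} (hU : IsOpen U) (hUA : U ⊆ A) {q : X → ℝ≥0∞} (hq : q ∈ dominatedCone W p₀)
    {y : X} {μ : Measure X} (hμ : IsReducedMeasure W A y μ) :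
    ∫⁻ x, reduced W U q x ∂μ = reduced W U q y := by
  obtain ⟨f, hf, hmono, hf0, hsup⟩ := hW.exists_reduced_isOpen_eq_iSup h₀ hpos hU hq
  have hR := fun n => hW.reduced_univ_mem_dominatedCone (hf n)
  simp only [hsup]
  rw [lintegral_iSup (fun n => (hR n).2.1.1.measurable)
    (fun m n hmn => reduced_mono subset_rfl fun y _ => hmono hmn y)]
  refine iSup_congr fun n => ?_
  rw [hμ _ (dominatedCone_subset_contPotentials h₀ (hR n))]
  refine le_antisymm (reduced_le (hR n).1 (fun _ _ => le_rfl) y)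
    (le_reduced fun w hw h => reduced_le hw (fun z _ => ?_) y)
  by_cases hz : z ∈ A
  · exact (le_reduced_of_mem (mem_univ z)).trans (h z hz)
  · simp [hf0 n z fun hzU => hz (hUA hzU)]

/-- If the closed set `A` is contained in the interior of `B`, then `ε_y^B ≤ ε_y^A` on `A`. -/
theorem restrict_reducedMeasure_le [LocallyCompactSpace X] {A B : Set X} (hA : IsClosed A)
    (hAB : A ⊆ interior B) (y : X) :
    (reducedMeasure W B y).restrict A ≤ reducedMeasure W A y := by
  obtain ⟨p₀, hp₀, q, hq, hpc, hqc, hpos, hq0, hlim⟩ := hW.exists_pos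
  have h₀ : p₀ ∈ contPotentials W := ⟨hp₀, hpc, q, hq, hqc, hq0, hlim⟩
  set μ := reducedMeasure W B y
  have hμ : IsReducedMeasure W B y μ := hW.isReducedMeasure_reducedMeasure B y
  have hν := hW.isReducedMeasure_reducedMeasure A y
  have hfin : ∀ p ∈ dominatedCone W p₀, reduced W A p y ≠ ∞ := fun p hp =>
    ne_top_of_le_ne_top (hp.2.1.2 y) (reduced_le hp.1 (fun _ _ => le_rfl) y)
  refine hW.measure_le_of_forall_posDifferences h₀ hpos ?_ ?_
  · rw [hν p₀ h₀]
    exact hfin p₀ (self_mem_dominatedCone h₀)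
  rintro f ⟨p, hp, v, hv, rfl⟩
  have hq := hW.inf_mem_dominatedCone hp hv.1 hv.2.1
  -- Replacing v by p ⊓ v makes the truncated difference a true one, so that its integral splits.
  have hf : p - v = p - p ⊓ v := by
    funext x
    rcases le_total (p x) (v x) with h | h <;> simp [h, tsub_eq_zero_of_le]
  rw [hf]
  set q := p ⊓ v
  have hqp : q ≤ p := inf_le_left
  have hqm : Measurable q := hq.2.1.1.measurable
  have hsub : ∫⁻ x, (p - q) x ∂(reducedMeasure W A y) = reduced W A p y - reduced W A q y := by
    rw [← hν p (dominatedCone_subset_contPotentials h₀ hp),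
      ← hν q (dominatedCone_subset_contPotentials h₀ hq)]
    refine lintegral_sub hqm ?_ (Eventually.of_forall hqp)
    rw [hν q (dominatedCone_subset_contPotentials h₀ hq)]
    exact hfin q hq
  rw [hsub]
  refine ENNReal.le_sub_of_add_le_right (hfin q hq) ?_
  refine le_trans (le_iInf₂ fun U hU => ?_) (hW.iInf_reduced_isOpen_le h₀ hpos hAB hp.2.1 y)
  have hm : Measurable (A.indicator (p - q)) :=
    (hp.2.1.sub hq.2.1).1.measurable.indicator hA.measurableSet
  calc ∫⁻ x in A, (p - q) x ∂μ + reduced W A q y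
      ≤ ∫⁻ x in A, (p - q) x ∂μ + reduced W U q y := by
        gcongr
        exact reduced_mono hU.2.1 (fun _ _ => le_rfl) y
    _ = ∫⁻ x, A.indicator (p - q) x + reduced W U q x ∂μ := by
        rw [← lintegral_indicator hA.measurableSet, lintegral_add_left hm,
          hW.lintegral_reduced_isOpen h₀ hpos hU.1 hU.2.2 hq hμ]
    _ ≤ ∫⁻ x, reduced W U p x ∂μ := by
        refine lintegral_mono fun x => ?_
        by_cases hx : x ∈ A
        · rw [indicator_of_mem hx]
          calc (p - q) x + reduced W U q x ≤ (p - q) x + q x :=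
                add_le_add le_rfl (reduced_le hq.1 (fun _ _ => le_rfl) x)
            _ = p x := tsub_add_cancel_of_le (hqp x)
            _ ≤ reduced W U p x := le_reduced_of_mem (hU.2.1 hx)
        · rw [indicator_of_notMem hx, zero_add]
          exact reduced_mono subset_rfl (fun y _ => hqp y) x
    _ = reduced W U p y := hW.lintegral_reduced_isOpen h₀ hpos hU.1 hU.2.2 hp hμ

end IsBalayageSpace

end Measures

/-! ### Estimates for the Green function and for balls. -/

section Green

variable {X : Type*} [MetricSpace X] [MeasurableSpace X] {W : Set (X → ℝ≥0∞)}
  {G : X → X → ℝ≥0∞} {g : ℝ → ℝ≥0∞} {c cD : ℝ≥0} {α₀ : ℝ} {η₀ : ℝ≥0} {R₀ : ℝ≥0∞}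

namespace GreenAssumption

variable (hG : GreenAssumption W G g c cD α₀ η₀ R₀)
include hG

/-- G(·, y) is finite off y, so g is finite at one positive distance below R₀; doubling carries this
to its dyadic fractions, and monotonicity to all t > 0. -/
theorem ne_top_of_exists_ne (hX : ∃ x y : X, x ≠ y ∧ ENNReal.ofReal (dist x y) < R₀) {t : ℝ}
    (ht : 0 < t) : g t ≠ ∞ := by
  obtain ⟨x, y, hxy, hd⟩ := hX
  have hd0 : 0 < dist x y := dist_pos.2 hxy
  have hn : ∀ n : ℕ, g (dist x y / 2 ^ n) ≠ ∞ := by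
    intro n
    induction n with
    | zero =>
      have hfin : G x y ≠ ∞ := (hG.harmonic y).2.2.1 x hxy
      have hlow := ne_top_of_le_ne_top hfin (hG.lower x y)
      intro h
      simp only [pow_zero, div_one] at h
      rw [h] at hlow
      exact hlow (ENNReal.mul_top (ENNReal.inv_ne_zero.2 ENNReal.coe_ne_top))
    | succ n ih =>
      have h := hG.doubling (dist x y / 2 ^ n) (by positivity)
        ((ENNReal.ofReal_le_ofReal (div_le_self hd0.le (one_le_pow₀ one_le_two))).trans_lt hd)
      rw [div_div, ← pow_succ] at h
      exact ne_top_of_le_ne_top (ENNReal.mul_ne_top ENNReal.coe_ne_top ih) h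
  obtain ⟨n, hn'⟩ := pow_unbounded_of_one_lt (dist x y / t) one_lt_two
  refine ne_top_of_le_ne_top (hn n) (hG.g_anti ?_ ht.le ?_)
  · exact div_nonneg hd0.le (by positivity)
  · rw [div_lt_iff₀ ht] at hn'
    rw [div_le_iff₀ (by positivity)]
    linarith

theorem iterated_decay {s : ℝ} (hs : 0 < s) (hs' : ENNReal.ofReal s < R₀) (k : ℕ) :
    g s ≤ (η₀ : ℝ≥0∞) ^ k * g (α₀ ^ k * s) := by
  induction k with
  | zero => simp
  | succ k ih =>
    have hle : α₀ ^ k * s ≤ s :=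
      mul_le_of_le_one_left hs.le (pow_le_one₀ hG.α₀_pos.le hG.α₀_lt.le)
    have h := hG.decay (α₀ ^ k * s) (mul_pos (pow_pos hG.α₀_pos k) hs)
      ((ENNReal.ofReal_le_ofReal hle).trans_lt hs')
    rw [← mul_assoc, ← pow_succ'] at h
    calc g s ≤ (η₀ : ℝ≥0∞) ^ k * g (α₀ ^ k * s) := ih
      _ ≤ (η₀ : ℝ≥0∞) ^ k * (η₀ * g (α₀ ^ (k + 1) * s)) := by gcongr
      _ = _ := by rw [pow_succ (η₀ : ℝ≥0∞), mul_assoc]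

/-- The Green function of a ball is comparable to `g` near the centre. -/
theorem exists_le_greenOn_ball (hW : IsBalayageSpace W) (h1 : (fun _ => 1) ∈ W)
    (hX : ∃ x y : X, x ≠ y ∧ ENNReal.ofReal (dist x y) < R₀) :
    ∃ κ : ℝ, 0 < κ ∧ ∀ (y z : X) (t : ℝ), 0 < t → ENNReal.ofReal t < R₀ → dist y z ≤ κ * t →
      g (dist y z) ≤ (2 * c : ℝ≥0) * greenOn W G (Metric.ball y t) y z := by
  have hc : 0 < c := zero_lt_one.trans_le hG.one_le_c
  -- This k gives c * η₀ ^ k ≤ 1 / (2c): after k decay steps the reduced part is at most half of the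
  -- lower bound c⁻¹ g for G, and the other half is left for G_V.
  obtain ⟨k, hk⟩ := exists_pow_lt_of_lt_one (show 0 < (2 * c)⁻¹ * c⁻¹ by positivity) hG.η₀_lt
  have hα : α₀ ^ k ≤ 1 := pow_le_one₀ hG.α₀_pos.le hG.α₀_lt.le
  refine ⟨α₀ ^ k / 2, half_pos (pow_pos hG.α₀_pos k), fun y z t ht htR hyz => ?_⟩
  have hyz2 : dist y z ≤ t / 2 := by nlinarith
  have hb : (c : ℝ≥0∞) * g (t / 2) ≠ ∞ :=
    ENNReal.mul_ne_top ENNReal.coe_ne_top (hG.ne_top_of_exists_ne hX (half_pos ht))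
  have hred : reduced W (Metric.ball y t)ᶜ (fun w => G w z) y ≤ c * g (t / 2) := by
    have hmem := hW.smul_mem ((c : ℝ≥0∞) * g (t / 2)).toNNReal _ h1
    simp only [ENNReal.coe_toNNReal hb, mul_one] at hmem
    refine reduced_le hmem (fun w hw => (hG.upper w z).trans ?_) y
    have hw' : t ≤ dist w y := by simpa using hw
    have := dist_triangle w z y
    rw [dist_comm z y] at this
    gcongr
    exact hG.g_anti (half_pos ht).le dist_nonneg (by linarith)
  have hdecay : (c : ℝ≥0∞) * g (t / 2) ≤ ((2 * c)⁻¹ : ℝ≥0) * g (dist y z) := by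
    have h := hG.iterated_decay (half_pos ht)
      ((ENNReal.ofReal_le_ofReal (half_le_self ht.le)).trans_lt htR) k
    have h' : g (α₀ ^ k * (t / 2)) ≤ g (dist y z) :=
      hG.g_anti dist_nonneg (mul_nonneg (pow_nonneg hG.α₀_pos.le k) (half_pos ht).le)
        (by linarith)
    have hck : c * η₀ ^ k ≤ (2 * c)⁻¹ := by
      calc c * η₀ ^ k ≤ c * ((2 * c)⁻¹ * c⁻¹) := by gcongr
        _ = (2 * c)⁻¹ := by field_simp
    calc (c : ℝ≥0∞) * g (t / 2) ≤ c * ((η₀ : ℝ≥0∞) ^ k * g (dist y z)) := by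
          gcongr
          exact h.trans (by gcongr)
      _ = (c * η₀ ^ k : ℝ≥0) * g (dist y z) := by push_cast; ring
      _ ≤ ((2 * c)⁻¹ : ℝ≥0) * g (dist y z) := by gcongr
  have hgreen : (((2 * c)⁻¹ : ℝ≥0) : ℝ≥0∞) * g (dist y z) ≤ greenOn W G (Metric.ball y t) y z := by
    refine ENNReal.le_sub_of_add_le_right (ne_top_of_le_ne_top hb hred) ?_
    calc (((2 * c)⁻¹ : ℝ≥0) : ℝ≥0∞) * g (dist y z) + reduced W (Metric.ball y t)ᶜ (fun w => G w z) y
        ≤ ((2 * c)⁻¹ : ℝ≥0) * g (dist y z) + ((2 * c)⁻¹ : ℝ≥0) * g (dist y z) :=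
          add_le_add le_rfl (hred.trans hdecay)
      _ = ((2 * c)⁻¹ + (2 * c)⁻¹ : ℝ≥0) * g (dist y z) := by push_cast; ring
      _ = (c : ℝ≥0∞)⁻¹ * g (dist y z) := by
          rw [← ENNReal.coe_inv hc.ne']
          congr 2
          field_simp
          norm_num
      _ ≤ G y z := hG.lower y z
  calc g (dist y z) = ((2 * c : ℝ≥0) : ℝ≥0∞) * (((2 * c)⁻¹ : ℝ≥0) * g (dist y z)) := by
        rw [← mul_assoc, ← ENNReal.coe_mul, mul_inv_cancel₀ (by positivity), ENNReal.coe_one,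
          one_mul]
    _ ≤ _ := by gcongr

theorem measurable_comp_dist [BorelSpace X] (x : X) : Measurable fun z => g (dist x z) := by
  -- g is decreasing on [0, ∞) only; max t 0 makes the composition antitone on all of ℝ.
  have h : Antitone fun t : ℝ => g (max t 0) := fun s t hst =>
    hG.g_anti (mem_Ici.2 (le_max_right s 0)) (mem_Ici.2 (le_max_right t 0)) (max_le_max hst le_rfl)
  have := h.measurable.comp (continuous_const.dist continuous_id : Continuous (dist x)).measurable
  convert this using 2 with z
  simp

end GreenAssumption

/-- For balls with the same centre the reduced measures increase with the radius, outside the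
larger ball. -/
theorem IsBalayageSpace.reducedMeasure_compl_ball_le [LocallyCompactSpace X]
    [SecondCountableTopology X] [BorelSpace X] (hW : IsBalayageSpace W) (y : X) {t r : ℝ}
    (htr : t < r) {E : Set X} (hEr : E ⊆ (Metric.ball y r)ᶜ) :
    reducedMeasure W (Metric.ball y t)ᶜ y E ≤ reducedMeasure W (Metric.ball y r)ᶜ y E := by
  have hA : IsClosed (Metric.ball y r)ᶜ := Metric.isOpen_ball.isClosed_compl
  have hint : (Metric.ball y r)ᶜ ⊆ interior (Metric.ball y t)ᶜ := by
    refine Subset.trans ?_ (interior_maximal (compl_subset_compl.2 Metric.ball_subset_closedBall)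
      Metric.isClosed_closedBall.isOpen_compl)
    exact compl_subset_compl.2 (Metric.closedBall_subset_ball htr)
  have h := hW.restrict_reducedMeasure_le hA hint y E
  rwa [Measure.restrict_eq_self _ hEr] at h

/-- Balls of radius below R₀ are singletons, so both reduced measures coincide. -/
theorem jumpAssumption_of_subsingleton_balls (hR₀ : 0 < R₀)
    (hX : ∀ x y : X, x ≠ y → R₀ ≤ ENNReal.ofReal (dist x y)) : JumpAssumption W := by
  refine ⟨R₀, 1, 1 / 4, hR₀, zero_lt_one, by norm_num, by norm_num, ?_⟩
  intro x r hr hrR y hy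
  have hball : ∀ z ∈ Metric.ball x r, z = x := by
    intro z hz
    by_contra hne
    exact absurd (hX z x hne) (not_le.2
      ((ENNReal.ofReal_le_ofReal (Metric.mem_ball.1 hz).le).trans_lt hrR))
  obtain rfl : y = x := hball y (Metric.ball_subset_ball (by linarith) hy)
  have : Metric.ball y (1 / 4 * r) = Metric.ball y r :=
    (Metric.ball_subset_ball (by linarith)).antisymm fun z hz => by
      rw [hball z hz]
      exact Metric.mem_ball_self (by linarith)
  rw [this]
  intro E _ _
  simp

end Green

end Balayage

/-! ### The chain of estimates. -/

open Balayage in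
theorem proposition7p2 {X : Type*} [MetricSpace X] [LocallyCompactSpace X]
    [SecondCountableTopology X] [MeasurableSpace X] [BorelSpace X]
    (W : Set (X → ℝ≥0∞)) (hW : Balayage.IsBalayageSpace W) (h1 : (fun _ => 1) ∈ W)
    (G : X → X → ℝ≥0∞) (g : ℝ → ℝ≥0∞) (c cD : ℝ≥0) (α₀ : ℝ) (η₀ : ℝ≥0) (R₀ : ℝ≥0∞)
    (hG : Balayage.GreenAssumption W G g c cD α₀ η₀ R₀)
    (lam : Measure X) (N : ProbabilityTheory.Kernel X X) (MN : ℝ) (CN : ℝ≥0)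
    (hMN : 3 ≤ MN) (hCN : 1 ≤ CN)
    (hIW : Balayage.IkedaWatanabe W G R₀ lam N MN CN)
    (C : ℝ≥0) (a R : ℝ) (hC : 1 ≤ C) (ha : 3 ≤ a) (hR : 0 < R)
    (hN : ∀ (x : X) (r : ℝ), 0 < r → r < R → ∀ y ∈ Metric.ball x r,
      Balayage.LEOn (Metric.ball y (a * r))ᶜ (N x) C (N y))
    (hint : ∀ (x : X) (r : ℝ), 0 < r → r < R → ∀ y ∈ Metric.ball x r,
      ∫⁻ z in Metric.ball x r, g (dist x z) ∂lam ≤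
        C * ∫⁻ z in Metric.ball y (2 * r), g (dist y z) ∂lam) :
    Balayage.JumpAssumption W := by
  -- Two distinct points at distance below R₀ are needed for g to be finite on (0, ∞).
  by_cases hX : ∃ x y : X, x ≠ y ∧ ENNReal.ofReal (dist x y) < R₀
  swap
  · push Not at hX
    exact jumpAssumption_of_subsingleton_balls hG.R₀_pos hX
  obtain ⟨κ, hκ, hgreen⟩ := hG.exists_le_greenOn_ball hW h1 hX
  have hc0 : 0 < c := zero_lt_one.trans_le hG.one_le_c
  have hC0 : 0 < C := zero_lt_one.trans_le hC
  have hCN0 : 0 < CN := zero_lt_one.trans_le hCN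
  -- The bounds give, in order: 2s ≤ κt, so the Green function estimate applies on B(y, 2s); 2s ≤ t
  -- and B(x, M_N s) ⊆ B(y, r); and B(z, 2as) ⊆ B(y, r) for z in B(y, 2s).
  obtain ⟨α, hα0, hα1, hα2, hα3⟩ : ∃ α : ℝ, 0 < α ∧ α * (2 * MN) ≤ κ ∧ α * (2 * MN + 1) ≤ 1 ∧
      α * (2 * a + 2) ≤ 1 := by
    refine ⟨min (κ / (2 * MN)) (min (1 / (2 * MN + 1)) (1 / (2 * a + 2))),
      lt_min (by positivity) (lt_min (by positivity) (by positivity)), ?_, ?_, ?_⟩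
    · exact (le_div_iff₀ (by positivity)).1 (min_le_left _ _)
    · exact (le_div_iff₀ (by positivity)).1 ((min_le_right _ _).trans (min_le_left _ _))
    · exact (le_div_iff₀ (by positivity)).1 ((min_le_right _ _).trans (min_le_right _ _))
  refine ⟨min R₀ (ENNReal.ofReal R), CN * (c * C * C * C * (2 * c * C * CN)), α,
    lt_min hG.R₀_pos (ENNReal.ofReal_pos.2 hR), by positivity, hα0, by nlinarith, ?_⟩
  intro x r hr hrR y hy E hE hEr
  have hrR₀ : ENNReal.ofReal r < R₀ := hrR.trans_le (min_le_left _ _)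
  have hrR' : r < R := (ENNReal.ofReal_lt_ofReal_iff hR).1 (hrR.trans_le (min_le_right _ _))
  set s := α * r with hs
  -- Chosen so that M_N t = r: the Ikeda–Watanabe estimate for B(y, t) then holds on all of B(y,
  -- r)^c.
  set t := r / MN with ht
  have hs0 : 0 < s := mul_pos hα0 hr
  have ht0 : 0 < t := div_pos hr (by positivity)
  have htr : t < r := div_lt_self hr (by linarith)
  have hMNs : 2 * MN * s + s ≤ r := by nlinarith
  have has : 2 * a * s + 2 * s ≤ r := by nlinarith
  have hsr : 2 * s < r := by nlinarith
  have hst : 2 * s ≤ κ * t := by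
    rw [ht, ← mul_div_assoc, le_div_iff₀ (by positivity)]
    nlinarith
  have hst' : 2 * s ≤ t := by
    rw [ht, le_div_iff₀ (by positivity)]
    nlinarith
  have hyx : dist y x < s := hy
  have hE' : ∀ w ∈ E, r ≤ dist w y := fun w hw => by simpa using hEr hw
  have hsub : ∀ (z : X) (b : ℝ), dist y z + b ≤ r → E ⊆ (Metric.ball z b)ᶜ := by
    intro z b hb w hw
    have h1 := hE' w hw
    have h2 := dist_triangle w z y
    rw [dist_comm z y] at h2
    simp only [mem_compl_iff, Metric.mem_ball, not_lt]
    linarith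
  have hofReal : ∀ b ≤ r, ENNReal.ofReal b < R₀ := fun b hb =>
    (ENNReal.ofReal_le_ofReal hb).trans_lt hrR₀
  have hupper : reducedMeasure W (Metric.ball x s)ᶜ x E ≤
      CN * ∫⁻ z in Metric.ball x s, greenOn W G (Metric.ball x s) x z * N z E ∂lam := by
    have h := (hIW x s hs0 (hofReal s (by linarith)) E hE (hsub x _ (by nlinarith))).1
    rwa [← ENNReal.div_eq_inv_mul, ENNReal.div_le_iff_le_mul (Or.inl (by simpa using hCN0.ne'))
      (Or.inl ENNReal.coe_ne_top), mul_comm] at h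
  have hNz : ∀ z ∈ Metric.ball x s, N z E ≤ C * N x E := fun z hz =>
    hN z s hs0 (by linarith) x (Metric.mem_ball_comm.1 hz) E hE (hsub x _ (by nlinarith))
  have hNxy : N x E ≤ C * N y E :=
    hN x s hs0 (by linarith) y hy E hE (hsub y _ (by rw [dist_self]; nlinarith))
  have hNyz : ∀ z ∈ Metric.ball y (2 * s), N y E ≤ C * N z E := fun z hz =>
    hN y (2 * s) (by linarith) (by linarith) z hz E hE
      (hsub z _ (by rw [dist_comm]; have := Metric.mem_ball.1 hz; linarith))
  have hint_x : ∫⁻ z in Metric.ball x s, greenOn W G (Metric.ball x s) x z * N z E ∂lam ≤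
      c * C * N x E * ∫⁻ z in Metric.ball x s, g (dist x z) ∂lam := by
    rw [← lintegral_const_mul _ (hG.measurable_comp_dist x)]
    refine setLIntegral_mono' Metric.isOpen_ball.measurableSet fun z hz => ?_
    calc greenOn W G (Metric.ball x s) x z * N z E ≤ c * g (dist x z) * (C * N x E) :=
          mul_le_mul' (tsub_le_self.trans (hG.upper x z)) (hNz z hz)
      _ = c * C * N x E * g (dist x z) := by ring
  have hint_y : N y E * ∫⁻ z in Metric.ball y (2 * s), g (dist y z) ∂lam ≤
      (2 * c * C * CN : ℝ≥0) * reducedMeasure W (Metric.ball y r)ᶜ y E := by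
    have hsubset : Metric.ball y (2 * s) ⊆ Metric.ball y t :=
      Metric.ball_subset_ball hst'
    have hIWy := (hIW y t ht0 (hofReal t htr.le) E hE
      (hsub y _ (by rw [dist_self, ht, mul_div_cancel₀ _ (by positivity)]; linarith))).2
    calc N y E * ∫⁻ z in Metric.ball y (2 * s), g (dist y z) ∂lam
        = ∫⁻ z in Metric.ball y (2 * s), N y E * g (dist y z) ∂lam :=
          (lintegral_const_mul _ (hG.measurable_comp_dist y)).symm
      _ ≤ ∫⁻ z in Metric.ball y (2 * s),
            (2 * c * C : ℝ≥0) * (greenOn W G (Metric.ball y t) y z * N z E) ∂lam := by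
          refine setLIntegral_mono' Metric.isOpen_ball.measurableSet fun z hz => ?_
          have hz' : dist y z ≤ κ * t := (Metric.mem_ball'.1 hz).le.trans hst
          calc N y E * g (dist y z)
              ≤ C * N z E * ((2 * c : ℝ≥0) * greenOn W G (Metric.ball y t) y z) :=
                mul_le_mul' (hNyz z hz) (hgreen y z t ht0 (hofReal t htr.le) hz')
            _ = _ := by push_cast; ring
      _ = (2 * c * C : ℝ≥0) *
            ∫⁻ z in Metric.ball y (2 * s), greenOn W G (Metric.ball y t) y z * N z E ∂lam :=
          lintegral_const_mul' _ _ ENNReal.coe_ne_top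
      _ ≤ (2 * c * C : ℝ≥0) * (CN * reducedMeasure W (Metric.ball y t)ᶜ y E) := by
          gcongr
          exact (lintegral_mono_set hsubset).trans hIWy
      _ ≤ (2 * c * C : ℝ≥0) * (CN * reducedMeasure W (Metric.ball y r)ᶜ y E) := by
          exact mul_le_mul' le_rfl
            (mul_le_mul' le_rfl (hW.reducedMeasure_compl_ball_le y htr hEr))
      _ = _ := by push_cast; ring
  calc reducedMeasure W (Metric.ball x s)ᶜ x E
      ≤ CN * (c * C * N x E * ∫⁻ z in Metric.ball x s, g (dist x z) ∂lam) :=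
        hupper.trans (by gcongr)
    _ ≤ CN * (c * C * (C * N y E) *
          (C * ∫⁻ z in Metric.ball y (2 * s), g (dist y z) ∂lam)) := by
        gcongr
        exact hint x s hs0 (by linarith) y hy
    _ = (CN * (c * C * C * C) : ℝ≥0) *
          (N y E * ∫⁻ z in Metric.ball y (2 * s), g (dist y z) ∂lam) := by push_cast; ring
    _ ≤ (CN * (c * C * C * C) : ℝ≥0) *
          ((2 * c * C * CN : ℝ≥0) * reducedMeasure W (Metric.ball y r)ᶜ y E) := by gcongr
    _ = _ := by push_cast; ring
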